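/- **Theorem (full-field learning: convergence rate for power law QoI).** *Notation.* For real sequences, $a_j\lesssim b_j$ and $a_j\asymp b_j$ as $j\to\infty$ mean that $|a_j|\le C|b_j|$, respectively $C^{-1}|b_j|\le |a_j|\le C|b_j|$, for some constant $C\geq 1$ and all large $j$. For $\beta\in\mathbb R$, $\mathcal H^\beta$ is the set of real sequences $v$ with $\sum_{j\ge1}j^{2\beta}|v_j|^2<\infty$. For a real random variable $X$, $\|X\|_{\psi_2}=\sup_{\ell\ge1}\ell^{-1/2}(\mathbb E|X|^\ell)^{1/\ell}$. *Setting.* Let $H$ be an infinite-dimensional separable real Hilbert space with orthonormal basis $\{\varphi_j\}_{j\in\mathbb N}$. Let $\alpha>1/2$, $\alpha'\ge0$ and $\beta,r\in\mathbb R$ satisfy $\min(\alpha,\alpha'+r+\tfrac12)+\beta>0$. Assume the following. 1. (Training inputs) $\nu$ is a centered Borel probability measure on $H$ with finite second moment and covariance operator $\Sigma=\sum_j\sigma_j\,\varphi_j\otimes\varphi_j$, where $\{\sigma_j\}$ is nonincreasing and $\sigma_j\asymp j^{-2\alpha}$. For $u\sim\nu$, the normalized Karhunen–Loève coefficients $z_j=\langle\varphi_j,u\rangle/\sqrt{\sigma_j}$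 are independent and $\sup_j\|z_j\|_{\psi_2}<\infty$. 2. (Test inputs) $\nu'$ is a centered probability measure with covariance $\Sigma'=\sum_j\sigma_j'\,\varphi_j\otimes\varphi_j$, where $\sigma'_j\lesssim j^{-2\alpha'}$. It lives on the space $\mathbb R^{\mathbb N}\supset H$ of coefficient sequences $u'=(u'_j)_j$ with respect to $\{\varphi_j\}$; that is, $\mathbb E\,u'_j=0$ and $\mathbb E\,u'_ju'_k=\sigma'_j\delta_{jk}$. 3. (Forward map) $L^\dagger=\sum_j l_j^\dagger\,\varphi_j\otimes\varphi_j$ is the (possibly unbounded) diagonal operator on $H$, with its maximal domain, with eigenvalue sequence $l^\dagger\in\mathcal H^\beta$. 4. (Prior) The eigenvalues are given independent priors $l_j\sim\mathcal N(0,\mu_j)$ with $\mu_j>0$ for all $j$ and $\mu_j\asymp j^{-2\beta-1}$. 5. (QoI) $q^\dagger$ is a (possibly unbounded) linear functional defined on a subspace of $H$ containing all $\varphi_j$, with $|q^\dagger(\varphi_j)|^2\lesssim j^{-2r-1}$, and $q^\dagger\circ L^\dagger$ is continuous: $\sum_j|q^\dagger(\varphi_j)|^2|l^\dagger_j|^2<\infty$.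 *Data and estimator.* Let $U=(u_1,\dots,u_N)\sim\nu^{\otimes N}$, and let $\Upsilon=(Y_1,\dots,Y_N)$ with $$Y_n=L^\dagger u_n+\eta_n,$$ where $\eta_1,\eta_2,\dots$ are iid Gaussian white noises $\mathcal N(0,\mathrm{Id}_H)$, independent of $U$; the $Y_n$ and $\eta_n$ are understood as processes indexed by $H$. The posterior distribution of the eigenvalue sequence given $(U,\Upsilon)$ is $\bigotimes_{j}\pi_j$, where $\pi_j$ is the Gaussian distribution on $\mathbb R$ whose density with respect to $\mathcal N(0,\mu_j)$ is proportional to $l\mapsto\exp\bigl(-\tfrac12\sum_{n=1}^N(Y_n(\varphi_j)-l\langle\varphi_j,u_n\rangle)^2\bigr)$. Let $\bar l^{(N)}_j$ be the mean of $\pi_j$ and $\bar L^{(N)}=\sum_j\bar l_j^{(N)}\varphi_j\otimes\varphi_j$. The plug-in estimator of $q^\dagger\circ L^\dagger$ is $q^\dagger\circ\bar L^{(N)}$. For $L=L^\dagger$ or $L=\bar L^{(N)}$, the value $q^\dagger(Lu')$ at $u'\sim\nu'$ is understood as the $L^2(\nu')$-limit as $n\to\infty$ of $q^\dagger\bigl(L\sum_{j\le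 n}u'_j\varphi_j\bigr)$; the squared test error is set to $+\infty$ if such a limit does not exist. *Claim.* There exist constants $c,C,K>0$ and $N_0\in\mathbb N$, none of them depending on $N$, such that for every $N\ge N_0$, with probability at least $1-Ce^{-cN}$ over $U\sim\nu^{\otimes N}$, $$\mathbb E^{\Upsilon\mid U}\,\mathbb E^{u'\sim\nu'}\bigl|q^\dagger(L^\dagger u')-q^\dagger(\bar L^{(N)}u')\bigr|^2\le K\,\varepsilon_N^2,$$ where $$\varepsilon_N^2=\begin{cases}N^{-\frac{1+2\alpha'+2\beta+2r}{1+2\alpha+2\beta}},&\alpha'+r<\alpha,\\ N^{-1}\log N,&\alpha'+r=\alpha,\\ N^{-1},&\alpha'+r>\alpha.\end{cases}$$ -/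

import Mathlib

open MeasureTheory ProbabilityTheory Filter Topology
open scoped ENNReal NNReal RealInnerProductSpace

noncomputable section

namespace FullField

/-! Sequences indexed by `j = 1, 2, 3, …` are indexed here by `j : ℕ` starting from `0`, so that the
number `j` of the usual notation is `(j : ℝ) + 1`. -/

/-- The power law sequence `1 ^ a, 2 ^ a, 3 ^ a, …`. -/
def powerLaw (a : ℝ) (j : ℕ) : ℝ := ((j : ℝ) + 1) ^ a

/-- Membership of a real sequence in the Sobolev-like space of order `s` (any real number):
`∑ j ^ (2 s) |v_j| ^ 2 < ∞`. -/
def MemSobolev (s : ℝ) (v : ℕ → ℝ) : Prop :=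
  Summable fun j => powerLaw (2 * s) j * |v j| ^ 2

/-- The subgaussian norm `sup_{ℓ ≥ 1} ℓ ^ (-1/2) (E |X| ^ ℓ) ^ (1/ℓ)`, with values in `[0, ∞]`. -/
def psi2Norm {Ω : Type*} [MeasurableSpace Ω] (X : Ω → ℝ) (P : Measure Ω) : ℝ≥0∞ :=
  ⨆ (ℓ : ℝ) (_ : 1 ≤ ℓ), eLpNorm X (ENNReal.ofReal ℓ) P / ENNReal.ofReal (Real.sqrt ℓ)

section Operators

variable {H : Type*} [NormedAddCommGroup H] [InnerProductSpace ℝ H]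

/-- The (possibly unbounded) self-adjoint operator `∑ l_j φ_j ⊗ φ_j`, with its maximal domain
`{h | ∑ l_j ^ 2 ⟪φ_j, h⟫ ^ 2 < ∞}`. -/
def diagonalOperator (φ : HilbertBasis ℕ ℝ H) (l : ℕ → ℝ) : H →ₗ.[ℝ] H where
  domain :=
    { carrier := {h | Memℓp (fun j => l j * ⟪φ j, h⟫) 2}
      zero_mem' := by
        simp only [Set.mem_ofPred_eq, inner_zero_right, mul_zero]
        exact zero_memℓp
      add_mem' := fun {a b} ha hb => by
        simp only [Set.mem_ofPred_eq, inner_add_right, mul_add] at *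
        exact ha.add hb
      smul_mem' := fun c a ha => by
        simp only [Set.mem_ofPred_eq, real_inner_smul_right, mul_left_comm] at *
        exact ha.const_smul c }
  toFun :=
    { toFun := fun h => φ.repr.symm ⟨fun j => l j * ⟪φ j, (h : H)⟫, h.2⟩
      map_add' := fun a b => by
        rw [← map_add]
        congr 1
        ext j
        simp only [Submodule.coe_add, inner_add_right, mul_add]
        rfl
      map_smul' := fun c a => by
        rw [RingHom.id_apply, ← map_smul]
        congr 1
        ext j
        simp [real_inner_smul_right, mul_left_comm] }

/-- The composition `q ∘ T` of a partially defined functional and a partially defined operator,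
on its natural domain `{h ∈ dom T | T h ∈ dom q}`. -/
def composition (q : H →ₗ.[ℝ] ℝ) (T : H →ₗ.[ℝ] H) : H →ₗ.[ℝ] ℝ :=
  q.comp (T.domRestrict ((q.domain.comap T.toFun).map T.domain.subtype)) (by
    rintro ⟨x, hx⟩
    obtain ⟨⟨y, hy, rfl⟩, hxT⟩ := hx
    exact hy)

/-- The partial sum `x_1 φ_1 + … + x_n φ_n` of the (formal) series with coefficients `x`. -/
def partialSum (φ : HilbertBasis ℕ ℝ H) (n : ℕ) (x : ℕ → ℝ) : H :=
  ∑ j ∈ Finset.range n, x j • φ j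

lemma basis_mem_domain (φ : HilbertBasis ℕ ℝ H) (l : ℕ → ℝ) (j : ℕ) :
    φ j ∈ (diagonalOperator φ l).domain := by
  change Memℓp (fun i => l i * ⟪φ i, φ j⟫) 2
  have h : (fun i => l i * ⟪φ i, φ j⟫) = fun i =>
      ((lp.single 2 j (l j) : lp (fun _ : ℕ => ℝ) 2) : ℕ → ℝ) i := by
    funext i
    rw [orthonormal_iff_ite.1 φ.orthonormal, lp.single_apply]
    by_cases hij : i = j
    · subst hij; simp
    · simp [hij]
  rw [h]
  exact lp.memℓp _

lemma diagonalOperator_basis (φ : HilbertBasis ℕ ℝ H) (l : ℕ → ℝ) (j : ℕ) :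
    diagonalOperator φ l ⟨φ j, basis_mem_domain φ l j⟩ = l j • φ j := by
  apply φ.repr.injective
  ext i
  rw [φ.repr_apply_apply, φ.repr_apply_apply]
  have : diagonalOperator φ l ⟨φ j, basis_mem_domain φ l j⟩
      = φ.repr.symm ⟨fun i => l i * ⟪φ i, φ j⟫, basis_mem_domain φ l j⟩ := rfl
  rw [← φ.repr_apply_apply, this, LinearIsometryEquiv.apply_symm_apply,
    real_inner_smul_right]
  change l i * ⟪φ i, φ j⟫ = _
  rw [orthonormal_iff_ite.1 φ.orthonormal]
  by_cases hij : i = j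
  · subst hij; simp
  · simp [hij]

lemma partialSum_mem_domain (φ : HilbertBasis ℕ ℝ H) (l : ℕ → ℝ) (q : H →ₗ.[ℝ] ℝ)
    (hq : ∀ j, φ j ∈ q.domain) (n : ℕ) (x : ℕ → ℝ) :
    partialSum φ n x ∈ (composition q (diagonalOperator φ l)).domain := by
  refine Submodule.sum_mem _ fun j _ => Submodule.smul_mem _ _ ?_
  refine ⟨⟨⟨φ j, basis_mem_domain φ l j⟩, ?_, rfl⟩, basis_mem_domain φ l j⟩
  change (diagonalOperator φ l) ⟨φ j, basis_mem_domain φ l j⟩ ∈ q.domain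
  rw [diagonalOperator_basis]
  exact Submodule.smul_mem _ _ (hq j)

end Operators

section Distributions

variable {H : Type*} [NormedAddCommGroup H] [InnerProductSpace ℝ H] [CompleteSpace H]
  [MeasurableSpace H] [BorelSpace H]

/-- The training input distribution: a centered (probability) measure `ν` on `H` with covariance
operator `∑ σ_j φ_j ⊗ φ_j`, nonincreasing eigenvalues `σ_j ≍ j ^ (-2 α)`, and with
Karhunen–Loève coefficients `z_j = ⟪φ_j, u⟫ / √σ_j` that are independent with uniformly bounded
subgaussian norms. (The `σ_j` are automatically positive, and the `z_j` automatically have zero mean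
and unit variance.) -/
structure IsTrainingInput (φ : HilbertBasis ℕ ℝ H) (ν : Measure H) (σ : ℕ → ℝ) (α : ℝ) :
    Prop where
  memLp : MemLp id 2 ν
  mean_eq_zero : ∫ u, u ∂ν = 0
  cov_eq : ∀ j, covarianceOperator ν (φ j) = σ j • φ j
  antitone : Antitone σ
  decay : σ =Θ[atTop] powerLaw (-2 * α)
  indep : iIndepFun (fun (j : ℕ) (u : H) => ⟪φ j, u⟫ / Real.sqrt (σ j)) ν
  subgaussian : ⨆ j : ℕ, psi2Norm (fun u : H => ⟪φ j, u⟫ / Real.sqrt (σ j)) ν < ∞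

/-- The test input distribution: a centered (probability) measure whose covariance is
`∑ σ'_j φ_j ⊗ φ_j` with `σ'_j ≲ j ^ (-2 α')`. As this covariance need not be of trace class, the
measure lives on a space larger than `H`, namely the space of all real sequences, in which `H` is
embedded through the coefficients `u ↦ (⟪φ_j, u⟫)_j`. -/
structure IsTestInput (ν' : Measure (ℕ → ℝ)) (σ' : ℕ → ℝ) (α' : ℝ) : Prop where
  memLp : ∀ j, MemLp (fun x => x j) 2 ν'
  mean_eq_zero : ∀ j, ∫ x, x j ∂ν' = 0
  cov_eq : ∀ j k, ∫ x, x j * x k ∂ν' = if j = k then σ' j else 0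
  decay : σ' =O[atTop] powerLaw (-2 * α')

/-- Gaussian white noise `N(0, Id_H)`: a centered Gaussian process indexed by `H` with covariance
`E[η(h) η(k)] = ⟪h, k⟫`. -/
structure IsWhiteNoise {Ω : Type*} [MeasurableSpace Ω] (η : H → Ω → ℝ) (P : Measure Ω) :
    Prop where
  isGaussianProcess : IsGaussianProcess η P
  mean_eq_zero : ∀ h, ∫ ω, η h ω ∂P = 0
  cov_eq : ∀ h k, ∫ ω, η h ω * η k ω ∂P = ⟪h, k⟫

end Distributions

section Estimator

/-- The posterior distribution of a real parameter `l` with prior `N(0, μ)` given `y_1, …, y_N`,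
where `y_n = l x_n + N(0, 1)` with independent noises and known `x_n`: it has a density
proportional to `exp (- ∑ (y_n - l x_n) ^ 2 / 2)` with respect to the prior. -/
def eigenvaluePosterior (μ : ℝ≥0) {N : ℕ} (x y : Fin N → ℝ) : Measure ℝ :=
  (gaussianReal 0 μ).tilted fun l => -(∑ n, (y n - l * x n) ^ 2) / 2

instance (μ : ℝ≥0) {N : ℕ} (x y : Fin N → ℝ) :
    IsProbabilityMeasure (eigenvaluePosterior μ x y) := by
  refine isProbabilityMeasure_tilted ?_
  refine Integrable.of_bound (C := 1) ?_ (ae_of_all _ fun l => ?_)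
  · exact Continuous.aestronglyMeasurable (by fun_prop)
  · rw [Real.norm_eq_abs, Real.abs_exp, Real.exp_le_one_iff]
    have : 0 ≤ ∑ n, (y n - l * x n) ^ 2 := Finset.sum_nonneg fun _ _ => sq_nonneg _
    linarith

variable {H : Type*} [NormedAddCommGroup H] [InnerProductSpace ℝ H]

open Classical in
/-- The observation `Y = T u + η`, as the `H`-indexed process `h ↦ ⟪T u, h⟫ + η(h)`. The value of
`⟪T u, h⟫` for `u` outside the domain of `T` is set to `0`. -/
def observation (T : H →ₗ.[ℝ] H) (u : H) (η : H → ℝ) (h : H) : ℝ :=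
  (if hu : u ∈ T.domain then ⟪T ⟨u, hu⟩, h⟫ else 0) + η h

/-- The posterior distribution of the eigenvalue sequence given the inputs `U` and the observations
`Y` (each an `H`-indexed process), for the prior under which the eigenvalues are independent with
distributions `N(0, μ_j)`. The eigenvalue `l_j` enters the observations only through
`Y_n(φ_j) = l_j ⟪φ_j, u_n⟫ + η_n(φ_j)`. -/
def posterior (φ : HilbertBasis ℕ ℝ H) (μ : ℕ → ℝ≥0) {N : ℕ} (U : Fin N → H)
    (Y : Fin N → H → ℝ) : Measure (ℕ → ℝ) :=
  Measure.infinitePi fun j =>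
    eigenvaluePosterior (μ j) (fun n => ⟪φ j, U n⟫) (fun n => Y n (φ j))

/-- The posterior mean eigenvalues. -/
def posteriorMean (φ : HilbertBasis ℕ ℝ H) (μ : ℕ → ℝ≥0) {N : ℕ} (U : Fin N → H)
    (Y : Fin N → H → ℝ) (j : ℕ) : ℝ :=
  ∫ l, l j ∂(posterior φ μ U Y)

/-- `g` is (a version of) the map `u' ↦ q (T u')`, `T = ∑ l_j φ_j ⊗ φ_j`, for `u' ~ ν'`: a square
integrable function, the limit in `L²(ν')` of `q (T u'_n)` where `u'_n = ∑_{j ≤ n} u'_j φ_j`. -/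
structure IsPtOMap (φ : HilbertBasis ℕ ℝ H) (ν' : Measure (ℕ → ℝ)) (q : H →ₗ.[ℝ] ℝ)
    (hq : ∀ j, φ j ∈ q.domain) (l : ℕ → ℝ) (g : (ℕ → ℝ) → ℝ) : Prop where
  memLp : MemLp g 2 ν'
  tendsto : Tendsto (fun n => eLpNorm (fun x => g x - composition q (diagonalOperator φ l)
      ⟨partialSum φ n x, partialSum_mem_domain φ l q hq n x⟩) 2 ν') atTop (𝓝 0)

/-- The squared test error `E^{u' ~ ν'} |q (L u') - q (L̂ u')| ^ 2` of the diagonal operators with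
eigenvalues `l` and `l̂`. Both maps are unique up to `ν'`-null sets, so all the terms of the infimum
agree; the value is `∞` if one of the maps does not exist in `L²(ν')`. -/
def testError (φ : HilbertBasis ℕ ℝ H) (ν' : Measure (ℕ → ℝ)) (q : H →ₗ.[ℝ] ℝ)
    (hq : ∀ j, φ j ∈ q.domain) (l lhat : ℕ → ℝ) : ℝ≥0∞ :=
  ⨅ (g : (ℕ → ℝ) → ℝ) (ghat : (ℕ → ℝ) → ℝ) (_ : IsPtOMap φ ν' q hq l g)
    (_ : IsPtOMap φ ν' q hq lhat ghat), ∫⁻ x, ENNReal.ofReal (|g x - ghat x| ^ 2) ∂ν'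

/-- The conditional expectation given the inputs `U` of the squared test error of the plug-in
estimator: as the noise is independent of the inputs, the conditional law of the observations given
`U` is the law of `(L u_n + η_n)_n` with `U` held fixed. -/
def expectedTestError (φ : HilbertBasis ℕ ℝ H) (ν' : Measure (ℕ → ℝ)) (q : H →ₗ.[ℝ] ℝ)
    (hq : ∀ j, φ j ∈ q.domain) (l : ℕ → ℝ) (μ : ℕ → ℝ≥0) {Ω : Type*} [MeasurableSpace Ω]
    (P : Measure Ω) (η : ℕ → H → Ω → ℝ) {N : ℕ} (U : Fin N → H) : ℝ≥0∞ :=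
  ∫⁻ ω, testError φ ν' q hq l (posteriorMean φ μ U fun n =>
    observation (diagonalOperator φ l) (U n) fun h => η n h ω) ∂P

end Estimator

/-- The convergence rate (the square `ε_N ^ 2`). -/
def rate (α α' β r : ℝ) (N : ℕ) : ℝ :=
  if α' + r < α then (N : ℝ) ^ (-((1 + 2 * α' + 2 * β + 2 * r) / (1 + 2 * α + 2 * β)))
  else if α' + r = α then (N : ℝ)⁻¹ * Real.log N
  else (N : ℝ)⁻¹

end FullField

end

open FullField

namespace FullField

/-! ### Power law sequences -/

/-! The problem decouples into scalar ridge regressions. Given `U`, coordinate `j` carries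
information `S_j = σ_j Z_j` with `Z_j = ∑ n, z_{j,n} ^ 2`, and its posterior mean has mean squared
error `ridgeRisk` (`lintegral_posteriorMean_sub_sq`). Test coordinates are orthogonal in `L²(ν')`,
so the test error is the sum of the coordinate errors with weights `w_j = σ'_j q(φ_j)²`, at most of
order `j^{-(1+2α'+2r)}` (`IsTestInput.testError_le`, `expectedTestError_le`).

With `ρ = 1 + 2α + 2β`, the product `S_j μ_j` behaves like `N j^{-ρ}`, so data and prior balance at
`J = ⌊N^{1/ρ}⌋`. Below `J` the data dominate: the variance sum is `N⁻¹ ∑_{j<J} j^{2(α-α'-r)-1}`, and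
the sign of `α - α' - r` produces the three regimes of the rate (`exists_variance_sum_le_rate`).
Beyond `J` the prior dominates: the risk is at most `l_j² + μ_j² S_j`. The bias on both sides is
controlled by the Sobolev sum of `l` (`exists_weighted_risk_le_rate`).

Randomness of `U` enters only through a lower bound on `Z_j` for `j < J` and an upper bound on
weighted sums of `Z_j` over `j ≥ J`. The former is a union bound over at most `N` coordinates, the
latter one Chernoff bound for an averaged variable (`exists_concentration_event`). -/

lemma powerLaw_pos (a : ℝ) (j : ℕ) : 0 < powerLaw a j := by
  unfold powerLaw; positivity

lemma powerLaw_add (a b : ℝ) (j : ℕ) : powerLaw (a + b) j = powerLaw a j * powerLaw b j :=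
  Real.rpow_add (by positivity) _ _

lemma powerLaw_neg (a : ℝ) (j : ℕ) : powerLaw (-a) j = (powerLaw a j)⁻¹ :=
  Real.rpow_neg (by positivity) _

lemma exists_le_mul_powerLaw {f : ℕ → ℝ} {a : ℝ} (h : f =O[atTop] powerLaw a) :
    ∃ C > 0, ∀ j, f j ≤ C * powerLaw a j := by
  obtain ⟨C, hC, hb⟩ := Asymptotics.bound_of_isBigO_nat_atTop h
  refine ⟨C, hC, fun j => (le_abs_self _).trans ?_⟩
  simpa [abs_of_pos (powerLaw_pos a j)] using hb (powerLaw_pos a j).ne'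

lemma exists_mul_powerLaw_le {f : ℕ → ℝ} {a : ℝ} (h : powerLaw a =O[atTop] f)
    (hf : ∀ j, 0 < f j) : ∃ c > 0, ∀ j, c * powerLaw a j ≤ f j := by
  obtain ⟨C, hC, hb⟩ := Asymptotics.bound_of_isBigO_nat_atTop h
  refine ⟨C⁻¹, inv_pos.2 hC, fun j => ?_⟩
  have := hb (hf j).ne'
  rw [Real.norm_eq_abs, Real.norm_eq_abs, abs_of_pos (powerLaw_pos a j), abs_of_pos (hf j)] at this
  rwa [inv_mul_le_iff₀ hC]

/-- A discrete integral comparison, made to telescope. After division by `(y+1)^t`, Bernoulli's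
inequality settles `t ≤ 1` and monotonicity of powers settles `t ≥ 1`; the constant `1 + 1/t` covers
both. -/
lemma sub_one_mul_rpow_le (t : ℝ) (ht : 0 < t) (y : ℝ) (hy : 0 ≤ y) :
    (y + 1) ^ (t - 1) ≤ (1 + 1 / t) * ((y + 1) ^ t - y ^ t) := by
  have hy1 : 0 < y + 1 := by linarith
  have hu0 : 0 ≤ y / (y + 1) := by positivity
  have hu1 : y / (y + 1) ≤ 1 := by rw [div_le_one hy1]; linarith
  have hyt : y ^ t = (y + 1) ^ t * (y / (y + 1)) ^ t := by
    rw [← Real.mul_rpow hy1.le hu0, mul_div_cancel₀ _ hy1.ne']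
  have hk : (y + 1)⁻¹ ≤ (1 + 1 / t) * (1 - (y / (y + 1)) ^ t) := by
    have hu : y / (y + 1) = 1 + -(y + 1)⁻¹ := by field_simp; ring
    have hinv : 0 < (y + 1)⁻¹ := inv_pos.2 hy1
    rcases le_total t 1 with h | h
    · have := rpow_one_add_le_one_add_mul_self (s := -(y + 1)⁻¹) (by linarith) ht.le h
      rw [hu]
      calc (y + 1)⁻¹ = (1 / t) * (t * (y + 1)⁻¹) := by field_simp
        _ ≤ (1 + 1 / t) * (t * (y + 1)⁻¹) := by gcongr; linarith
        _ ≤ _ := by gcongr; linarith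
    · have := Real.rpow_le_rpow_of_exponent_ge' hu0 hu1 zero_le_one h
      rw [Real.rpow_one] at this
      have h1 : (y + 1)⁻¹ ≤ 1 - (y / (y + 1)) ^ t := by linarith
      have : 0 ≤ 1 / t := by positivity
      nlinarith
  rw [hyt, Real.rpow_sub_one hy1.ne', div_eq_mul_inv]
  have := mul_le_mul_of_nonneg_left hk (Real.rpow_nonneg hy1.le t)
  linarith

lemma sum_range_powerLaw_le {t : ℝ} (ht : 0 < t) (n : ℕ) :
    ∑ j ∈ Finset.range n, powerLaw (t - 1) j ≤ (1 + 1 / t) * (n : ℝ) ^ t := by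
  induction n with
  | zero => simp [ht.ne']
  | succ n ih =>
    rw [Finset.sum_range_succ]
    have := sub_one_mul_rpow_le t ht n (Nat.cast_nonneg n)
    unfold powerLaw at *
    push_cast
    linarith

/-- The telescoping comparison for convergent tails. It comes from `u^{-t} = exp(-t log u) ≥ 1 - t
log u ≥ 1 + t(1 - u)` at `u = y/(y+1)`. -/
lemma neg_sub_one_rpow_le (t : ℝ) (ht : 0 < t) (y : ℝ) (hy : 0 < y) :
    (y + 1) ^ (-t - 1) ≤ (1 / t) * (y ^ (-t) - (y + 1) ^ (-t)) := by
  have hy1 : 0 < y + 1 := by linarith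
  have hu0 : 0 < y / (y + 1) := by positivity
  have hyt : y ^ (-t) = (y + 1) ^ (-t) * (y / (y + 1)) ^ (-t) := by
    rw [← Real.mul_rpow hy1.le hu0.le, mul_div_cancel₀ _ hy1.ne']
  have hk : t * (y + 1)⁻¹ ≤ (y / (y + 1)) ^ (-t) - 1 := by
    rw [Real.rpow_def_of_pos hu0]
    have h1 := Real.add_one_le_exp (Real.log (y / (y + 1)) * -t)
    have h2 := Real.log_le_sub_one_of_pos hu0
    have hu : y / (y + 1) = 1 + -(y + 1)⁻¹ := by field_simp; ring
    have h3 : Real.log (y / (y + 1)) ≤ -(y + 1)⁻¹ := by linarith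
    nlinarith
  have hk' : (y + 1)⁻¹ ≤ (1 / t) * ((y / (y + 1)) ^ (-t) - 1) := by
    calc (y + 1)⁻¹ = (1 / t) * (t * (y + 1)⁻¹) := by field_simp
      _ ≤ _ := by gcongr
  rw [hyt, Real.rpow_sub_one hy1.ne', div_eq_mul_inv]
  have := mul_le_mul_of_nonneg_left hk' (Real.rpow_nonneg hy1.le (-t))
  linarith

lemma sum_Ico_powerLaw_le {t : ℝ} (ht : 0 < t) {n : ℕ} (hn : 0 < n) (m : ℕ) :
    ∑ j ∈ Finset.Ico n m, powerLaw (-t - 1) j ≤ (1 / t) * (n : ℝ) ^ (-t) := by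
  rcases le_total m n with h | h
  · rw [Finset.Ico_eq_empty_of_le h, Finset.sum_empty]; positivity
  -- The bound with the subtracted endpoint term is the one that survives induction on `m`.
  suffices ∑ j ∈ Finset.Ico n m, powerLaw (-t - 1) j
      ≤ (1 / t) * ((n : ℝ) ^ (-t) - (m : ℝ) ^ (-t)) by
    refine this.trans ?_
    gcongr
    have : (0 : ℝ) ≤ (m : ℝ) ^ (-t) := by positivity
    linarith
  induction m, h using Nat.le_induction with
  | base => simp
  | succ k hk ih =>
    rw [Finset.sum_Ico_succ_top hk]
    have := neg_sub_one_rpow_le t ht k (by exact_mod_cast hn.trans_le hk)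
    unfold powerLaw at *
    push_cast
    linarith

lemma sum_range_powerLaw_neg_le {t : ℝ} (ht : 0 < t) (n : ℕ) :
    ∑ j ∈ Finset.range n, powerLaw (-t - 1) j ≤ 1 + 1 / t := by
  calc ∑ j ∈ Finset.range n, powerLaw (-t - 1) j
      ≤ ∑ j ∈ insert 0 (Finset.Ico 1 n), powerLaw (-t - 1) j := by
        refine Finset.sum_le_sum_of_subset_of_nonneg (fun j hj => ?_)
          fun j _ _ => (powerLaw_pos _ _).le
        simp only [Finset.mem_range, Finset.mem_insert, Finset.mem_Ico] at *
        omega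
    _ ≤ _ := by
        rw [Finset.sum_insert (by simp)]
        have := sum_Ico_powerLaw_le ht one_pos n
        simp only [Nat.cast_one, Real.one_rpow, mul_one] at this
        simpa [powerLaw] using this

lemma sum_range_powerLaw_neg_one_le (n : ℕ) :
    ∑ j ∈ Finset.range n, powerLaw (-1) j ≤ 1 + Real.log n := by
  refine le_trans (le_of_eq ?_) (harmonic_le_one_add_log n)
  simp [harmonic, powerLaw, Real.rpow_neg_one]

/-! ### The rate -/

/-- No regime is faster than the parametric one. The assumption `3 ≤ N` ensures `log N ≥ 1`. -/
lemma inv_le_rate {α α' β r : ℝ} (hρ : 0 < 1 + 2 * α + 2 * β) {N : ℕ} (hN : 3 ≤ N) :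
    (N : ℝ)⁻¹ ≤ rate α α' β r N := by
  have hN' : (3 : ℝ) ≤ N := by exact_mod_cast hN
  have hlog : 1 ≤ Real.log N := by
    rw [Real.le_log_iff_exp_le (by linarith)]
    linarith [Real.exp_one_lt_d9]
  have hinv : 0 < (N : ℝ)⁻¹ := by positivity
  unfold rate
  split_ifs with h1 h2
  · rw [← Real.rpow_neg_one]
    refine Real.rpow_le_rpow_of_exponent_le (by linarith) ?_
    rw [neg_le_neg_iff, div_le_one hρ]
    linarith
  · nlinarith
  · exact le_rfl

lemma rpow_le_rate {α α' β r : ℝ} (hρ : 0 < 1 + 2 * α + 2 * β) {N : ℕ} (hN : 3 ≤ N) :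
    (N : ℝ) ^ (-((1 + 2 * α' + 2 * β + 2 * r) / (1 + 2 * α + 2 * β))) ≤ rate α α' β r N := by
  by_cases h1 : α' + r < α
  · simp [rate, h1]
  · refine le_trans ?_ (inv_le_rate hρ hN)
    rw [← Real.rpow_neg_one (N : ℝ)]
    refine Real.rpow_le_rpow_of_exponent_le (by exact_mod_cast (by omega : 1 ≤ N)) ?_
    rw [neg_le_neg_iff, one_le_div hρ]
    linarith

/-- The summand over `N` is the order of `w_j / (N σ_j)`. Its sum up to `J` grows like `J^t` with `t
= 2(α-α'-r)`, like `log J`, or stays bounded. In the first case `N⁻¹ N^{t/ρ}` has exponent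
`-(ρ-t)/ρ`, exactly that of the rate. -/
lemma exists_variance_sum_le_rate {α α' β r : ℝ} (hρ : 1 < 1 + 2 * α + 2 * β) :
    ∃ C > 0, ∀ N : ℕ, 3 ≤ N →
      (N : ℝ)⁻¹ * ∑ j ∈ Finset.range ⌊(N : ℝ) ^ (1 / (1 + 2 * α + 2 * β))⌋₊,
        powerLaw (2 * (α - (α' + r)) - 1) j ≤ C * rate α α' β r N := by
  set ρ := 1 + 2 * α + 2 * β with hρdef
  have hρ0 : 0 < ρ := by linarith
  rcases lt_trichotomy (α' + r) α with h | h | h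
  · set t := 2 * (α - (α' + r)) with ht
    have ht0 : 0 < t := by linarith
    refine ⟨1 + 1 / t, by positivity, fun N hN => ?_⟩
    have hN0 : (0 : ℝ) < N := by exact_mod_cast (by omega : 0 < N)
    calc _ ≤ (N : ℝ)⁻¹ * ((1 + 1 / t) * (⌊(N : ℝ) ^ (1 / ρ)⌋₊ : ℝ) ^ t) := by
          gcongr; exact sum_range_powerLaw_le ht0 _
      _ ≤ (N : ℝ)⁻¹ * ((1 + 1 / t) * ((N : ℝ) ^ (1 / ρ)) ^ t) := by
          gcongr; exact Nat.floor_le (by positivity)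
      _ = (1 + 1 / t) * (N : ℝ) ^ (-1 + 1 / ρ * t) := by
          rw [Real.rpow_add hN0, Real.rpow_mul hN0.le, Real.rpow_neg_one]; ring
      _ = _ := by
          rw [rate, if_pos h]
          have hθ : 1 + 2 * α' + 2 * β + 2 * r = ρ - t := by rw [ht, hρdef]; ring
          rw [hθ, sub_div, div_self hρ0.ne']
          congr 2
          ring
  · refine ⟨2, by norm_num, fun N hN => ?_⟩
    have hN' : (3 : ℝ) ≤ N := by exact_mod_cast hN
    have hlog : 1 ≤ Real.log N := by
      rw [Real.le_log_iff_exp_le (by linarith)]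
      linarith [Real.exp_one_lt_d9]
    have hx1 : 1 ≤ (N : ℝ) ^ (1 / ρ) := Real.one_le_rpow (by linarith) (by positivity)
    have hJ : 0 < ⌊(N : ℝ) ^ (1 / ρ)⌋₊ := Nat.floor_pos.2 hx1
    have hJ' : (0 : ℝ) < ⌊(N : ℝ) ^ (1 / ρ)⌋₊ := by exact_mod_cast hJ
    have hxN : (N : ℝ) ^ (1 / ρ) ≤ N := by
      conv_rhs => rw [← Real.rpow_one (N : ℝ)]
      refine Real.rpow_le_rpow_of_exponent_le (by linarith) ?_
      rw [div_le_one hρ0]; exact hρ.le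
    rw [h, sub_self, mul_zero, zero_sub, rate, if_neg h.not_lt, if_pos h]
    have h1 := sum_range_powerLaw_neg_one_le ⌊(N : ℝ) ^ (1 / ρ)⌋₊
    have h2 : Real.log ⌊(N : ℝ) ^ (1 / ρ)⌋₊ ≤ Real.log N :=
      Real.log_le_log hJ' ((Nat.floor_le (by positivity)).trans hxN)
    calc _ ≤ (N : ℝ)⁻¹ * (2 * Real.log N) := by gcongr; linarith
      _ = _ := by ring
  · set t := -(2 * (α - (α' + r))) with ht
    have ht0 : 0 < t := by linarith
    refine ⟨1 + 1 / t, by positivity, fun N hN => ?_⟩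
    have he : 2 * (α - (α' + r)) - 1 = -t - 1 := by linarith
    rw [he, mul_comm]
    exact mul_le_mul (sum_range_powerLaw_neg_le ht0 _) (inv_le_rate hρ0 hN) (by positivity)
      (by positivity)

/-! ### The bias-variance decomposition -/

/-- The mean squared error of the posterior mean of `l` under the prior `N(0, m)`, when the
information in the data is `S`. -/
noncomputable def ridgeRisk (l m S : ℝ) : ℝ := (l ^ 2 * m⁻¹ ^ 2 + S) / (S + m⁻¹) ^ 2

lemma ridgeRisk_nonneg {l m S : ℝ} (hS : 0 ≤ S) : 0 ≤ ridgeRisk l m S := by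
  unfold ridgeRisk; positivity

/-- Dropping `m⁻¹` from the denominator: sharp when the data dominate the prior. -/
lemma ridgeRisk_le_of_pos {l m S : ℝ} (hm : 0 < m) (hS : 0 < S) :
    ridgeRisk l m S ≤ l ^ 2 * ((S * m)⁻¹) ^ 2 + S⁻¹ := by
  have h : l ^ 2 * ((S * m)⁻¹) ^ 2 + S⁻¹ = (l ^ 2 * m⁻¹ ^ 2 + S) / S ^ 2 := by
    field_simp
  rw [h, ridgeRisk]
  have : 0 < m⁻¹ := inv_pos.2 hm
  gcongr
  linarith

/-- Dropping `S` from the denominator: sharp when the prior dominates, and linear in `S`, so that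
only weighted sums of `S` need control. -/
lemma ridgeRisk_le {l m S : ℝ} (hm : 0 < m) (hS : 0 ≤ S) :
    ridgeRisk l m S ≤ l ^ 2 + m ^ 2 * S := by
  have h : l ^ 2 + m ^ 2 * S = (l ^ 2 * m⁻¹ ^ 2 + S) / (m⁻¹) ^ 2 := by
    field_simp
  rw [h, ridgeRisk]
  have : 0 < m⁻¹ := inv_pos.2 hm
  gcongr
  linarith

/-- With `x = N^{1/ρ}`, this is the bias factor multiplying the Sobolev terms of `l`. If `2ρ - θ ≥
0` it is largest at the cutoff and gives `x^{-θ}`; otherwise the power is at most `1`, leaving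
`x^{-2ρ} = N⁻²`. -/
lemma head_bias_le {ρ θ x : ℝ} (hx : 1 ≤ x) {j : ℕ}
    (hj : (j : ℝ) + 1 ≤ x) :
    powerLaw (2 * ρ - θ) j * x ^ (-(2 * ρ)) ≤ x ^ (-θ) + x ^ (-(2 * ρ)) := by
  have hx0 : 0 < x := by linarith
  have hp : 0 < x ^ (-(2 * ρ)) := by positivity
  have hp' : 0 < x ^ (-θ) := by positivity
  rcases le_total 0 (2 * ρ - θ) with h | h
  · have h1 : powerLaw (2 * ρ - θ) j ≤ x ^ (2 * ρ - θ) :=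
      Real.rpow_le_rpow (by positivity) hj h
    have h2 : x ^ (-θ) = x ^ (2 * ρ - θ) * x ^ (-(2 * ρ)) := by
      rw [← Real.rpow_add hx0]; ring_nf
    rw [h2]
    nlinarith
  · have h1 : powerLaw (2 * ρ - θ) j ≤ 1 :=
      Real.rpow_le_one_of_one_le_of_nonpos (by linarith [(Nat.cast_nonneg j : (0 : ℝ) ≤ j)]) h
    nlinarith

lemma tail_bias_le {θ x : ℝ} (hθ : 0 < θ) (hx : 1 ≤ x) {j : ℕ} (hj : x ≤ (j : ℝ) + 1) :
    powerLaw (-θ) j ≤ x ^ (-θ) :=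
  Real.rpow_le_rpow_of_nonpos (by linarith) hj (by linarith)

/-- Deterministic bound on the weighted risk. The numbers `Z j` stand for `∑ n, z_{j,n} ^ 2`. -/
theorem exists_weighted_risk_le_rate {α α' β r : ℝ} (hαβ : 0 < α + β)
    (hθ : 0 < 1 + 2 * α' + 2 * β + 2 * r) {w l σ m : ℕ → ℝ} {Cw Cσ cσ Cm cm : ℝ}
    (hCw : 0 < Cw) (hCσ : 0 < Cσ) (hcσ : 0 < cσ) (hCm : 0 < Cm) (hcm : 0 < cm)
    (hw0 : ∀ j, 0 ≤ w j) (hw : ∀ j, w j ≤ Cw * powerLaw (-(1 + 2 * α' + 2 * r)) j)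
    (hl : MemSobolev β l)
    (hσ : ∀ j, σ j ≤ Cσ * powerLaw (-2 * α) j) (hσ' : ∀ j, cσ * powerLaw (-2 * α) j ≤ σ j)
    (hm : ∀ j, m j ≤ Cm * powerLaw (-2 * β - 1) j)
    (hm' : ∀ j, cm * powerLaw (-2 * β - 1) j ≤ m j) {A : ℝ} (hA : 0 < A) :
    ∃ K > 0, ∀ N : ℕ, 3 ≤ N → ∀ Z : ℕ → ℝ, (∀ j, 0 ≤ Z j) →
      (∀ j < ⌊(N : ℝ) ^ (1 / (1 + 2 * α + 2 * β))⌋₊, (N : ℝ) / 4 ≤ Z j) →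
      (∀ k, ∑ j ∈ Finset.Ico ⌊(N : ℝ) ^ (1 / (1 + 2 * α + 2 * β))⌋₊ k,
          powerLaw (-(2 + 2 * α + 4 * β + 2 * α' + 2 * r) - 1) j * Z j
        ≤ A * N * ((1 / (2 + 2 * α + 4 * β + 2 * α' + 2 * r))
          * (⌊(N : ℝ) ^ (1 / (1 + 2 * α + 2 * β))⌋₊ : ℝ)
            ^ (-(2 + 2 * α + 4 * β + 2 * α' + 2 * r)))) →
      ∀ k, ∑ j ∈ Finset.range k, w j * ridgeRisk (l j) (m j) (σ j * Z j)
        ≤ K * rate α α' β r N := by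
  set ρ := 1 + 2 * α + 2 * β with hρdef
  set θ := 1 + 2 * α' + 2 * β + 2 * r with hθdef
  set κ := 1 + 2 * α' + 2 * r with hκdef
  have hs : 2 + 2 * α + 4 * β + 2 * α' + 2 * r = θ + ρ := by rw [hθdef, hρdef]; ring
  rw [hs]
  have hρ1 : 1 < ρ := by linarith
  have hρ : 0 < ρ := by linarith
  obtain ⟨C₁, hC₁, hvar⟩ := exists_variance_sum_le_rate (α' := α') (r := r) hρ1
  have hσ0 : ∀ j, 0 < σ j := fun j => (mul_pos hcσ (powerLaw_pos _ j)).trans_le (hσ' j)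
  have hm0 : ∀ j, 0 < m j := fun j => (mul_pos hcm (powerLaw_pos _ j)).trans_le (hm' j)
  set a : ℕ → ℝ := fun j => powerLaw (2 * β) j * |l j| ^ 2 with ha
  have ha0 : ∀ j, 0 ≤ a j := fun j => mul_nonneg (powerLaw_pos _ _).le (by positivity)
  have hla : ∀ j, l j ^ 2 = powerLaw (-(2 * β)) j * a j := fun j => by
    rw [ha, powerLaw_neg]
    simp only
    rw [inv_mul_cancel_left₀ (powerLaw_pos _ _).ne', sq_abs]
  set B := ∑' j, a j with hB
  have hB0 : 0 ≤ B := tsum_nonneg ha0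
  have hsum : ∀ s : Finset ℕ, ∑ j ∈ s, a j ≤ B := fun s => hl.sum_le_tsum s fun j _ => ha0 j
  set d := cσ * cm / 4 with hd
  have hd0 : 0 < d := by positivity
  -- The four summands account for head bias, head variance, tail bias and tail variance, in that
  -- order.
  refine ⟨Cw * (d⁻¹ ^ 2) * B * 2 + Cw * 4 / cσ * C₁ + Cw * B * 1 + Cw * Cm ^ 2 * Cσ * A
    * ((1 / (θ + ρ)) * (2 ^ (θ + ρ))), by positivity, ?_⟩
  intro N hN Z hZ0 hZ hZs k
  have hN' : (3 : ℝ) ≤ N := by exact_mod_cast hN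
  have hN0 : (0 : ℝ) < N := by linarith
  set x := (N : ℝ) ^ (1 / ρ) with hx
  have hx1 : 1 ≤ x := Real.one_le_rpow (by linarith) (by positivity)
  have hx0 : 0 < x := by linarith
  have hxρ : x ^ ρ = N := by
    rw [hx, ← Real.rpow_mul hN0.le, one_div_mul_cancel hρ.ne', Real.rpow_one]
  have hxθ : x ^ (-θ) ≤ rate α α' β r N := by
    rw [hx, ← Real.rpow_mul hN0.le]
    convert rpow_le_rate hρ hN using 2
    rw [one_div_mul_eq_div, neg_div]
  have hx2ρ : x ^ (-(2 * ρ)) = (N : ℝ)⁻¹ ^ 2 := by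
    rw [Real.rpow_neg hx0.le, mul_comm 2 ρ, Real.rpow_mul hx0.le, hxρ, Real.rpow_two, inv_pow]
  have hNrate := inv_le_rate (α := α) (α' := α') (β := β) (r := r) hρ hN
  have hN2 : x ^ (-(2 * ρ)) ≤ rate α α' β r N := by
    refine le_trans ?_ hNrate
    rw [hx2ρ]
    have : (N : ℝ)⁻¹ ≤ 1 := inv_le_one_of_one_le₀ (by linarith)
    have h0 : 0 < (N : ℝ)⁻¹ := by positivity
    nlinarith
  have hR0 : 0 < rate α α' β r N := (inv_pos.2 hN0).trans_le hNrate
  set J := ⌊x⌋₊ with hJ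
  have hJ1 : 1 ≤ J := Nat.floor_pos.2 hx1
  -- Rounding down costs at most a factor `2`, the source of `2 ^ (θ + ρ)` in the constant.
  have hJx : x / 2 ≤ J := by
    have h1 := Nat.lt_floor_add_one x
    have h2 : (1 : ℝ) ≤ J := by exact_mod_cast hJ1
    linarith
  have hr0 : ∀ j, 0 ≤ w j * ridgeRisk (l j) (m j) (σ j * Z j) := fun j =>
    mul_nonneg (hw0 j) (ridgeRisk_nonneg (mul_nonneg (hσ0 j).le (hZ0 j)))
  have hhead : ∀ j ∈ Finset.range J, w j * ridgeRisk (l j) (m j) (σ j * Z j)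
      ≤ Cw * (d⁻¹ ^ 2) * (2 * rate α α' β r N) * a j
        + Cw * 4 / cσ * ((N : ℝ)⁻¹ * powerLaw (2 * (α - (α' + r)) - 1) j) := by
    intro j hj
    rw [Finset.mem_range] at hj
    have hjx : (j : ℝ) + 1 ≤ x := by
      refine le_trans ?_ (Nat.floor_le hx0.le)
      exact_mod_cast hj
    have hZj := hZ j hj
    have hZp : 0 < Z j := by linarith
    have hσj := hσ0 j
    have hmj := hm0 j
    have hSp : 0 < σ j * Z j := mul_pos (hσ0 j) hZp
    have hSm : d * N * powerLaw (-ρ) j ≤ σ j * Z j * m j := by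
      have e : powerLaw (-ρ) j = powerLaw (-2 * α) j * powerLaw (-2 * β - 1) j := by
        rw [← powerLaw_add]; congr 1; rw [hρdef]; ring
      calc d * N * powerLaw (-ρ) j
          = (cσ * powerLaw (-2 * α) j) * (N / 4) * (cm * powerLaw (-2 * β - 1) j) := by
            rw [e, hd]; ring
        _ ≤ _ := by
          have := powerLaw_pos (-2 * β - 1) j
          gcongr
          · exact hσ' j
          · exact hm' j
    have hS : cσ * powerLaw (-2 * α) j * (N / 4) ≤ σ j * Z j := by
      have := powerLaw_pos (-2 * α) j
      gcongr
      exact hσ' j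
    have hpρ := powerLaw_pos (-ρ) j
    have hpα := powerLaw_pos (-2 * α) j
    have hpκ := powerLaw_pos (-κ) j
    have hb := head_bias_le (ρ := ρ) (θ := θ) hx1 hjx
    calc w j * ridgeRisk (l j) (m j) (σ j * Z j)
        ≤ (Cw * powerLaw (-κ) j) * (l j ^ 2 * ((σ j * Z j * m j)⁻¹) ^ 2 + (σ j * Z j)⁻¹) := by
          gcongr
          · exact ridgeRisk_nonneg hSp.le
          · exact hw j
          · exact ridgeRisk_le_of_pos (hm0 j) hSp
      _ ≤ (Cw * powerLaw (-κ) j) * (l j ^ 2 * ((d * N * powerLaw (-ρ) j)⁻¹) ^ 2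
            + (cσ * powerLaw (-2 * α) j * (N / 4))⁻¹) := by
          gcongr
      _ = Cw * (d⁻¹ ^ 2) * (powerLaw (2 * ρ - θ) j * x ^ (-(2 * ρ))) * a j
          + Cw * 4 / cσ * ((N : ℝ)⁻¹ * powerLaw (2 * (α - (α' + r)) - 1) j) := by
          have e1 : powerLaw (2 * ρ - θ) j
              = powerLaw (-κ) j * powerLaw (-(2 * β)) j * (powerLaw (-ρ) j)⁻¹ ^ 2 := by
            rw [← powerLaw_neg, sq, ← powerLaw_add, ← powerLaw_add, ← powerLaw_add]
            congr 1; rw [hθdef, hκdef]; ring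
          have e2 : powerLaw (2 * (α - (α' + r)) - 1) j
              = powerLaw (-κ) j * (powerLaw (-2 * α) j)⁻¹ := by
            rw [← powerLaw_neg, ← powerLaw_add]
            congr 1; rw [hκdef]; ring
          rw [hx2ρ, hla, e1, e2]
          field_simp
      _ ≤ _ := by
          have h2 : powerLaw (2 * ρ - θ) j * x ^ (-(2 * ρ)) ≤ 2 * rate α α' β r N := by linarith
          exact add_le_add (mul_le_mul_of_nonneg_right
            (mul_le_mul_of_nonneg_left h2 (by positivity)) (ha0 j)) le_rfl
  have htail : ∀ j ∈ Finset.Ico J k, w j * ridgeRisk (l j) (m j) (σ j * Z j)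
      ≤ Cw * rate α α' β r N * a j
        + Cw * Cm ^ 2 * Cσ * (powerLaw (-(θ + ρ) - 1) j * Z j) := by
    intro j hj
    rw [Finset.mem_Ico] at hj
    have hjx : x ≤ (j : ℝ) + 1 := by
      refine (Nat.lt_floor_add_one x).le.trans ?_
      have : (J : ℝ) ≤ j := by exact_mod_cast hj.1
      linarith
    have hS0 : 0 ≤ σ j * Z j := mul_nonneg (hσ0 j).le (hZ0 j)
    have hpκ := powerLaw_pos (-κ) j
    have hZj := hZ0 j
    have := ha0 j
    have hmj := hm0 j
    have hσj := hσ0 j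
    calc w j * ridgeRisk (l j) (m j) (σ j * Z j)
        ≤ (Cw * powerLaw (-κ) j) * (l j ^ 2 + m j ^ 2 * (σ j * Z j)) := by
          gcongr
          · exact ridgeRisk_nonneg hS0
          · exact hw j
          · exact ridgeRisk_le (hm0 j) hS0
      _ ≤ (Cw * powerLaw (-κ) j) * (l j ^ 2
            + (Cm * powerLaw (-2 * β - 1) j) ^ 2 * ((Cσ * powerLaw (-2 * α) j) * Z j)) := by
          gcongr
          · exact hm j
          · exact hσ j
      _ = Cw * powerLaw (-θ) j * a j + Cw * Cm ^ 2 * Cσ * (powerLaw (-(θ + ρ) - 1) j * Z j) := by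
          have e1 : powerLaw (-θ) j = powerLaw (-κ) j * powerLaw (-(2 * β)) j := by
            rw [← powerLaw_add]; congr 1; rw [hθdef, hκdef]; ring
          have e2 : powerLaw (-(θ + ρ) - 1) j
              = powerLaw (-κ) j * powerLaw (-2 * β - 1) j ^ 2 * powerLaw (-2 * α) j := by
            rw [sq, ← powerLaw_add, ← powerLaw_add, ← powerLaw_add]
            congr 1; rw [hθdef, hκdef, hρdef]; ring
          rw [hla, e1, e2]
          ring
      _ ≤ _ := by
          gcongr
          exact (tail_bias_le hθ hx1 hjx).trans hxθ
  -- The tail variance matches the bias because `N = x^ρ`, hence `N x^{-(θ+ρ)} = x^{-θ}`.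
  have hts : A * N * ((1 / (θ + ρ)) * (J : ℝ) ^ (-(θ + ρ)))
      ≤ A * ((1 / (θ + ρ)) * (2 ^ (θ + ρ))) * rate α α' β r N := by
    have hJp : (J : ℝ) ^ (-(θ + ρ)) ≤ 2 ^ (θ + ρ) * x ^ (-(θ + ρ)) := by
      calc (J : ℝ) ^ (-(θ + ρ)) ≤ (x / 2) ^ (-(θ + ρ)) :=
            Real.rpow_le_rpow_of_nonpos (by positivity) hJx (by linarith)
        _ = _ := by
            rw [Real.div_rpow hx0.le (by norm_num), Real.rpow_neg (by norm_num : (0 : ℝ) ≤ 2)]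
            field_simp
    have hNx : (N : ℝ) * x ^ (-(θ + ρ)) = x ^ (-θ) := by
      rw [← hxρ, ← Real.rpow_add hx0]; congr 1; ring
    calc _ ≤ A * N * ((1 / (θ + ρ)) * (2 ^ (θ + ρ) * x ^ (-(θ + ρ)))) := by
          gcongr
      _ = A * ((1 / (θ + ρ)) * (2 ^ (θ + ρ))) * (N * x ^ (-(θ + ρ))) := by ring
      _ ≤ _ := by rw [hNx]; gcongr
  have hsub : Finset.range k ⊆ Finset.range J ∪ Finset.Ico J k := fun j hj => by
    simp only [Finset.mem_union, Finset.mem_range, Finset.mem_Ico] at *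
    omega
  have hdisj : Disjoint (Finset.range J) (Finset.Ico J k) := by
    rw [Finset.disjoint_left]
    intro j hj
    simp only [Finset.mem_range, Finset.mem_Ico] at *
    omega
  calc ∑ j ∈ Finset.range k, w j * ridgeRisk (l j) (m j) (σ j * Z j)
      ≤ ∑ j ∈ Finset.range J ∪ Finset.Ico J k, w j * ridgeRisk (l j) (m j) (σ j * Z j) :=
        Finset.sum_le_sum_of_subset_of_nonneg hsub fun j _ _ => hr0 j
    _ ≤ ∑ j ∈ Finset.range J, (Cw * (d⁻¹ ^ 2) * (2 * rate α α' β r N) * a j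
          + Cw * 4 / cσ * ((N : ℝ)⁻¹ * powerLaw (2 * (α - (α' + r)) - 1) j))
        + ∑ j ∈ Finset.Ico J k, (Cw * rate α α' β r N * a j
          + Cw * Cm ^ 2 * Cσ * (powerLaw (-(θ + ρ) - 1) j * Z j)) := by
        rw [Finset.sum_union hdisj]
        exact add_le_add (Finset.sum_le_sum hhead) (Finset.sum_le_sum htail)
    _ = Cw * (d⁻¹ ^ 2) * (2 * rate α α' β r N) * ∑ j ∈ Finset.range J, a j
        + Cw * 4 / cσ * ((N : ℝ)⁻¹ * ∑ j ∈ Finset.range J, powerLaw (2 * (α - (α' + r)) - 1) j)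
        + (Cw * rate α α' β r N * ∑ j ∈ Finset.Ico J k, a j
        + Cw * Cm ^ 2 * Cσ * ∑ j ∈ Finset.Ico J k, powerLaw (-(θ + ρ) - 1) j * Z j) := by
        simp only [Finset.sum_add_distrib, Finset.mul_sum]
    _ ≤ Cw * (d⁻¹ ^ 2) * (2 * rate α α' β r N) * B
        + Cw * 4 / cσ * (C₁ * rate α α' β r N)
        + (Cw * rate α α' β r N * B
        + Cw * Cm ^ 2 * Cσ * (A * ((1 / (θ + ρ)) * (2 ^ (θ + ρ))) * rate α α' β r N)) := by
        refine add_le_add (add_le_add ?_ ?_) (add_le_add ?_ ?_) <;>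
          refine mul_le_mul_of_nonneg_left ?_ (by positivity)
        · exact hsum _
        · exact hvar N hN
        · exact hsum _
        · exact (hZs k).trans hts
    _ = _ := by ring

/-! ### Concentration -/

section Concentration

variable {X : Type*} [MeasurableSpace X]

/-- Chernoff's bound: the exponential moment of an iid sum factorizes, and Markov's inequality is
applied at level `1`. -/
lemma measure_pi_sum_nonneg_le (ν : Measure X) [IsProbabilityMeasure ν] {f : X → ℝ}
    (hf : Measurable f) {c : ℝ}
    (h : ∫⁻ u, ENNReal.ofReal (Real.exp (f u)) ∂ν ≤ ENNReal.ofReal (Real.exp (-c))) (N : ℕ) :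
    (Measure.pi fun _ : Fin N => ν) {U | 0 ≤ ∑ n, f (U n)}
      ≤ ENNReal.ofReal (Real.exp (-c * N)) := by
  set g : X → ℝ≥0∞ := fun u => ENNReal.ofReal (Real.exp (f u)) with hg
  have hgm : Measurable g := by fun_prop
  have hF : ∀ U : Fin N → X, ∏ n, g (U n) = ENNReal.ofReal (Real.exp (∑ n, f (U n))) := by
    intro U
    rw [Real.exp_sum, ENNReal.ofReal_prod_of_nonneg fun _ _ => (Real.exp_pos _).le]
  have hind : iIndepFun (fun (n : Fin N) (U : Fin N → X) => g (U n))
      (Measure.pi fun _ : Fin N => ν) :=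
    iIndepFun_pi (X := fun (_ : Fin N) => g) fun _ => hgm.aemeasurable
  have hint : ∫⁻ U, ∏ n, g (U n) ∂(Measure.pi fun _ : Fin N => ν) = (∫⁻ u, g u ∂ν) ^ N := by
    rw [lintegral_prod_eq_prod_lintegral_of_indepFun Finset.univ _ hind
      fun n => hgm.comp (measurable_pi_apply n)]
    have : ∀ n : Fin N, ∫⁻ U, g (U n) ∂(Measure.pi fun _ : Fin N => ν) = ∫⁻ u, g u ∂ν :=
      fun n => (measurePreserving_eval (fun _ : Fin N => ν) n).lintegral_comp hgm
    simp [this]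
  have hm : Measurable fun U : Fin N → X => ∏ n, g (U n) :=
    Finset.measurable_prod _ fun n _ => hgm.comp (measurable_pi_apply n)
  have hmk := mul_meas_ge_le_lintegral (μ := Measure.pi fun _ : Fin N => ν) hm 1
  rw [one_mul, hint] at hmk
  calc _ ≤ (Measure.pi fun _ : Fin N => ν) {U | 1 ≤ ∏ n, g (U n)} := by
        refine measure_mono fun U (hU : 0 ≤ ∑ n, f (U n)) => ?_
        change 1 ≤ ∏ n, g (U n)
        rw [hF, ← ENNReal.ofReal_one]
        exact ENNReal.ofReal_le_ofReal (Real.one_le_exp hU)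
    _ ≤ (∫⁻ u, g u ∂ν) ^ N := hmk
    _ ≤ (ENNReal.ofReal (Real.exp (-c))) ^ N := by gcongr
    _ = _ := by
        rw [← ENNReal.ofReal_pow (Real.exp_pos _).le, ← Real.exp_nat_mul, mul_comm]

lemma lintegral_pow_le_of_psi2Norm_le {P : Measure X} {Z : X → ℝ} {B : ℝ} (hB : 0 < B)
    (h : psi2Norm Z P ≤ ENNReal.ofReal B) {k : ℕ} (hk : 1 ≤ k) :
    ∫⁻ u, ENNReal.ofReal (Z u ^ (2 * k)) ∂P ≤ ENNReal.ofReal ((B ^ 2 * (2 * k)) ^ k) := by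
  have hk1 : (1 : ℝ) ≤ k := by exact_mod_cast hk
  have hℓ : (1 : ℝ) ≤ 2 * k := by linarith
  have hs : (0 : ℝ) < Real.sqrt (2 * k) := Real.sqrt_pos.2 (by linarith)
  have h1 : eLpNorm Z (ENNReal.ofReal (2 * k)) P / ENNReal.ofReal (Real.sqrt (2 * k))
      ≤ ENNReal.ofReal B := le_trans (le_iSup₂ (f := fun (ℓ : ℝ) (_ : 1 ≤ ℓ) =>
        eLpNorm Z (ENNReal.ofReal ℓ) P / ENNReal.ofReal (Real.sqrt ℓ)) (2 * k : ℝ) hℓ) h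
  rw [ENNReal.div_le_iff (by simpa using hs) ENNReal.ofReal_ne_top,
    ← ENNReal.ofReal_mul hB.le,
    eLpNorm_eq_lintegral_rpow_enorm_toReal (by simp; omega) ENNReal.ofReal_ne_top,
    ENNReal.toReal_ofReal (by linarith)] at h1
  have h2 := ENNReal.rpow_le_rpow h1 (z := (2 * k : ℝ)) (by linarith)
  rw [← ENNReal.rpow_mul, one_div_mul_cancel (by linarith), ENNReal.rpow_one] at h2
  convert h2 using 1
  · refine lintegral_congr fun u => ?_
    have : (2 * k : ℝ) = ((2 * k : ℕ) : ℝ) := by push_cast; ring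
    rw [this, ENNReal.rpow_natCast, Real.enorm_eq_ofReal_abs,
      ← ENNReal.ofReal_pow (abs_nonneg _), pow_mul, pow_mul, sq_abs]
  · have : (2 * k : ℝ) = ((2 * k : ℕ) : ℝ) := by push_cast; ring
    rw [ENNReal.ofReal_rpow_of_nonneg (by positivity) (by linarith)]
    congr 1
    conv_rhs => rw [this, Real.rpow_natCast, pow_mul, mul_pow, ← this, Real.sq_sqrt (by linarith)]

/-- Expanding the exponential, the moment bound and `k^k / k! ≤ e^k` bound the `k`-th term by `(2e t
B²)^k`. The value `t = 1/(4eB²)` makes this `2^{-k}`, which sums to `2`. -/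
lemma lintegral_exp_sq_le {P : Measure X} [IsProbabilityMeasure P] {Z : X → ℝ}
    (hZ : Measurable Z) {B : ℝ} (hB : 0 < B) (h : psi2Norm Z P ≤ ENNReal.ofReal B) :
    ∫⁻ u, ENNReal.ofReal (Real.exp ((4 * Real.exp 1 * B ^ 2)⁻¹ * Z u ^ 2)) ∂P ≤ 2 := by
  set t := (4 * Real.exp 1 * B ^ 2)⁻¹ with ht
  have ht0 : 0 < t := by positivity
  have hexp : ∀ u, ENNReal.ofReal (Real.exp (t * Z u ^ 2))
      = ∑' k : ℕ, ENNReal.ofReal ((t ^ k / k.factorial) * Z u ^ (2 * k)) := by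
    intro u
    have hs := NormedSpace.expSeries_div_hasSum_exp (𝔸 := ℝ) (t * Z u ^ 2)
    rw [← Real.exp_eq_exp_ℝ] at hs
    rw [← hs.tsum_eq, ENNReal.ofReal_tsum_of_nonneg (fun k => by positivity) hs.summable]
    refine tsum_congr fun k => ?_
    congr 1
    rw [mul_pow, pow_mul]; ring
  simp_rw [hexp]
  rw [lintegral_tsum fun k => by fun_prop]
  calc _ ≤ ∑' k : ℕ, ENNReal.ofReal ((1 / 2 : ℝ) ^ k) := by
        refine ENNReal.tsum_le_tsum fun k => ?_
        rcases Nat.eq_zero_or_pos k with rfl | hk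
        · simp
        have hc : 0 ≤ t ^ k / k.factorial := by positivity
        simp_rw [ENNReal.ofReal_mul hc]
        rw [lintegral_const_mul _ (by fun_prop)]
        calc _ ≤ ENNReal.ofReal (t ^ k / k.factorial)
              * ENNReal.ofReal ((B ^ 2 * (2 * k)) ^ k) := by
              gcongr; exact lintegral_pow_le_of_psi2Norm_le hB h hk
          _ ≤ _ := by
              rw [← ENNReal.ofReal_mul hc]
              refine ENNReal.ofReal_le_ofReal ?_
              have hf := Real.pow_div_factorial_le_exp (k : ℝ) (Nat.cast_nonneg k) k
              have e1 : t ^ k / k.factorial * (B ^ 2 * (2 * k)) ^ k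
                  = (t * B ^ 2 * 2) ^ k * ((k : ℝ) ^ k / k.factorial) := by
                rw [mul_pow, mul_pow, mul_pow, mul_pow]; ring
              have e2 : t * B ^ 2 * 2 = (1 / 2) * (Real.exp 1)⁻¹ := by
                rw [ht]; field_simp; norm_num
              rw [e1, e2, mul_pow, mul_assoc]
              refine mul_le_of_le_one_right (by positivity) ?_
              rw [inv_pow, ← Real.exp_nat_mul, mul_one]
              rw [inv_mul_le_iff₀ (Real.exp_pos _), mul_one]
              exact hf
    _ = 2 := by
        rw [← ENNReal.ofReal_tsum_of_nonneg (fun k => by positivity)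
          summable_geometric_two, tsum_geometric_two]
        simp

/-- A lower tail for `Z²` needs only a fourth moment: with `t = 1/M`, `E exp(-t Z²) ≤ 1 - t + t² M /
2 = 1 - t/2 ≤ e^{-t/2}`, and the factor `e^{t/4}` uses up half of the exponent. -/
lemma lintegral_exp_quarter_sub_sq_le {P : Measure X} [IsProbabilityMeasure P] {Z : X → ℝ}
    (hZ : Measurable Z) (h2 : ∫⁻ u, ENNReal.ofReal (Z u ^ 2) ∂P = 1) {M : ℝ} (hM : 0 < M)
    (h4 : ∫⁻ u, ENNReal.ofReal (Z u ^ 4) ∂P ≤ ENNReal.ofReal M) :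
    ∫⁻ u, ENNReal.ofReal (Real.exp (M⁻¹ * (1 / 4 - Z u ^ 2))) ∂P
      ≤ ENNReal.ofReal (Real.exp (-(M⁻¹ / 4))) := by
  have i2 : Integrable (fun u => Z u ^ 2) P :=
    (lintegral_ofReal_ne_top_iff_integrable (by fun_prop)
      (ae_of_all _ fun u => sq_nonneg _)).1 (by rw [h2]; simp)
  have i4 : Integrable (fun u => Z u ^ 4) P :=
    (lintegral_ofReal_ne_top_iff_integrable (by fun_prop)
      (ae_of_all _ fun u => by positivity)).1 (ne_top_of_le_ne_top ENNReal.ofReal_ne_top h4)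
  have e2 : ∫ u, Z u ^ 2 ∂P = 1 := by
    rw [integral_eq_lintegral_of_nonneg_ae (ae_of_all _ fun u => sq_nonneg _) (by fun_prop), h2]
    simp
  have e4 : ∫ u, Z u ^ 4 ∂P ≤ M := by
    rw [integral_eq_lintegral_of_nonneg_ae (ae_of_all _ fun u => by positivity) (by fun_prop)]
    exact ENNReal.toReal_le_of_le_ofReal hM.le h4
  set t := M⁻¹ with ht
  have ht0 : 0 < t := inv_pos.2 hM
  -- Follows from `(1 + y + y²/2)(1 - y + y²/2) = 1 + y⁴/4 ≥ 1`.
  have hq : ∀ y : ℝ, 0 ≤ y → Real.exp (-y) ≤ 1 - y + y ^ 2 / 2 := by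
    intro y hy
    have h1 := Real.quadratic_le_exp_of_nonneg hy
    have h3 : 0 < 1 + y + y ^ 2 / 2 := by positivity
    rw [Real.exp_neg]
    calc (Real.exp y)⁻¹ ≤ (1 + y + y ^ 2 / 2)⁻¹ := inv_anti₀ h3 h1
      _ ≤ _ := by
        rw [inv_le_iff_one_le_mul₀ h3]
        nlinarith [sq_nonneg (y ^ 2)]
  have hb : ∀ u, Real.exp (t * (1 / 4 - Z u ^ 2))
      ≤ Real.exp (t / 4) * (1 - t * Z u ^ 2 + t ^ 2 / 2 * Z u ^ 4) := by
    intro u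
    have := hq (t * Z u ^ 2) (by positivity)
    rw [show t * (1 / 4 - Z u ^ 2) = t / 4 + -(t * Z u ^ 2) by ring, Real.exp_add]
    gcongr
    calc _ ≤ _ := this
      _ = _ := by ring
  have ib : Integrable (fun u => Real.exp (t / 4) * (1 - t * Z u ^ 2 + t ^ 2 / 2 * Z u ^ 4)) P :=
    (((integrable_const _).sub (i2.const_mul _)).add (i4.const_mul _)).const_mul _
  calc _ ≤ ∫⁻ u, ENNReal.ofReal (Real.exp (t / 4) * (1 - t * Z u ^ 2 + t ^ 2 / 2 * Z u ^ 4)) ∂P :=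
        lintegral_mono fun u => ENNReal.ofReal_le_ofReal (hb u)
    _ = ENNReal.ofReal (∫ u, Real.exp (t / 4) * (1 - t * Z u ^ 2 + t ^ 2 / 2 * Z u ^ 4) ∂P) :=
        (ofReal_integral_eq_lintegral_ofReal ib
          (ae_of_all _ fun u => (Real.exp_pos _).le.trans (hb u))).symm
    _ ≤ _ := by
        refine ENNReal.ofReal_le_ofReal ?_
        have i3 : Integrable (fun u => 1 - t * Z u ^ 2) P :=
          (integrable_const _).sub (i2.const_mul _)
        rw [integral_const_mul, integral_add i3 (i4.const_mul _), integral_sub (integrable_const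
            _) (i2.const_mul _),
          integral_const_mul, integral_const_mul, e2]
        simp only [integral_const, probReal_univ, smul_eq_mul, mul_one]
        have h5 : 1 - t + t ^ 2 / 2 * ∫ u, Z u ^ 4 ∂P ≤ Real.exp (-(t / 2)) := by
          have : t ^ 2 / 2 * ∫ u, Z u ^ 4 ∂P ≤ t ^ 2 / 2 * M := by gcongr
          have e : t ^ 2 / 2 * M = t / 2 := by rw [ht]; field_simp
          have := Real.add_one_le_exp (-(t / 2))
          linarith
        calc _ ≤ Real.exp (t / 4) * Real.exp (-(t / 2)) := by gcongr
          _ = _ := by rw [← Real.exp_add]; congr 1; ring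

/-- By convexity of `exp`, a convex combination has an exponential moment no worse than the uniform
bound for its members, whatever their joint law. -/
lemma lintegral_exp_sum_le {P : Measure X} {Y : ℕ → X → ℝ} (hY : ∀ j, Measurable (Y j))
    {M : ℝ≥0∞} (h : ∀ j, ∫⁻ u, ENNReal.ofReal (Real.exp (Y j u)) ∂P ≤ M)
    {s : Finset ℕ} {p : ℕ → ℝ} (hp : ∀ j ∈ s, 0 ≤ p j) (hp1 : ∑ j ∈ s, p j = 1) :
    ∫⁻ u, ENNReal.ofReal (Real.exp (∑ j ∈ s, p j * Y j u)) ∂P ≤ M := by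
  calc _ ≤ ∫⁻ u, ∑ j ∈ s, ENNReal.ofReal (p j) * ENNReal.ofReal (Real.exp (Y j u)) ∂P := by
        refine lintegral_mono fun u => ?_
        have := convexOn_exp.map_sum_le (p := fun j => Y j u) hp hp1 fun _ _ => Set.mem_univ _
        simp only [smul_eq_mul] at this
        refine (ENNReal.ofReal_le_ofReal this).trans (le_of_eq ?_)
        rw [ENNReal.ofReal_sum_of_nonneg fun j hj => mul_nonneg (hp j hj) (Real.exp_pos _).le]
        exact Finset.sum_congr rfl fun j hj => ENNReal.ofReal_mul (hp j hj)
    _ = ∑ j ∈ s, ENNReal.ofReal (p j) * ∫⁻ u, ENNReal.ofReal (Real.exp (Y j u)) ∂P := by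
        rw [lintegral_finsetSum _ fun j _ => by have := hY j; fun_prop]
        refine Finset.sum_congr rfl fun j _ => lintegral_const_mul _ (by have := hY j; fun_prop)
    _ ≤ ∑ j ∈ s, ENNReal.ofReal (p j) * M := by gcongr with j; exact h j
    _ = M := by
        rw [← Finset.sum_mul, ← ENNReal.ofReal_sum_of_nonneg hp, hp1]; simp

end Concentration

/-- Absorbs the union-bound factor `N` by halving the exponential rate. -/
lemma natCast_mul_exp_le {c : ℝ} (hc : 0 < c) (N : ℕ) :
    N * Real.exp (-c * N) ≤ 2 / c * Real.exp (-(c / 2) * N) := by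
  have h := Real.add_one_le_exp (c / 2 * N)
  have e : Real.exp (-(c / 2) * N) = Real.exp (c / 2 * N) * Real.exp (-c * N) := by
    rw [← Real.exp_add]; congr 1; ring
  rw [e, ← mul_assoc]
  gcongr
  rw [div_mul_eq_mul_div, le_div_iff₀ hc]
  linarith

section Concentration

variable {X : Type*} [MeasurableSpace X]

lemma exists_measure_sum_sq_le (ν : Measure X) [IsProbabilityMeasure ν] {Z : ℕ → X → ℝ}
    (hZ : ∀ j, Measurable (Z j)) (hZ2 : ∀ j, ∫⁻ u, ENNReal.ofReal (Z j u ^ 2) ∂ν = 1) {B : ℝ}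
    (hB : 0 < B) (hsub : ∀ j, psi2Norm (Z j) ν ≤ ENNReal.ofReal B) :
    ∃ c > 0, ∀ (N j : ℕ), (Measure.pi fun _ : Fin N => ν)
      {U | ∑ n, Z j (U n) ^ 2 ≤ N / 4} ≤ ENNReal.ofReal (Real.exp (-c * N)) := by
  -- `M` is the fourth moment bound, the case `k = 2` of `lintegral_pow_le_of_psi2Norm_le`.
  obtain ⟨M, hM⟩ : ∃ M, M = (B ^ 2 * (2 * 2)) ^ 2 := ⟨_, rfl⟩
  have hM0 : 0 < M := by rw [hM]; positivity
  refine ⟨M⁻¹ / 4, by positivity, fun N j => ?_⟩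
  refine (measure_mono fun U hU => ?_).trans
    (measure_pi_sum_nonneg_le ν (f := fun u => M⁻¹ * (1 / 4 - Z j u ^ 2))
      (by have := hZ j; fun_prop) ?_ N)
  · replace hU : ∑ n, Z j (U n) ^ 2 ≤ N / 4 := hU
    change 0 ≤ ∑ n, M⁻¹ * (1 / 4 - Z j (U n) ^ 2)
    rw [← Finset.mul_sum, Finset.sum_sub_distrib]
    refine mul_nonneg (inv_pos.2 hM0).le ?_
    simp only [Finset.sum_const, Finset.card_univ, Fintype.card_fin, nsmul_eq_mul]
    linarith
  · refine lintegral_exp_quarter_sub_sq_le (hZ j) (hZ2 j) hM0 ?_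
    simpa [hM] using lintegral_pow_le_of_psi2Norm_le hB (hsub j) one_le_two

lemma exists_measure_weighted_sum_sq_le (ν : Measure X) [IsProbabilityMeasure ν] {Z : ℕ → X → ℝ}
    (hZ : ∀ j, Measurable (Z j)) {B : ℝ} (hB : 0 < B)
    (hsub : ∀ j, psi2Norm (Z j) ν ≤ ENNReal.ofReal B) :
    ∃ A > 0, ∀ (N : ℕ) (v : ℕ → ℝ) (s : Finset ℕ), (∀ j, 0 < v j) → s.Nonempty →
      (Measure.pi fun _ : Fin N => ν)
        {U | A * N * ∑ j ∈ s, v j < ∑ j ∈ s, v j * ∑ n, Z j (U n) ^ 2}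
          ≤ ENNReal.ofReal (Real.exp (-1 * N)) := by
  obtain ⟨t, ht⟩ : ∃ t, t = (4 * Real.exp 1 * B ^ 2)⁻¹ := ⟨_, rfl⟩
  have ht0 : 0 < t := by rw [ht]; positivity
  -- Averaging with weights `v j / W` keeps the exponential moment at most `2`; centering by `2`
  -- then gives `2 e^{-2} ≤ e^{-1}` per sample, hence the rate `1`.
  refine ⟨2 / t, by positivity, fun N v s hv hs => ?_⟩
  obtain ⟨W, hW⟩ : ∃ W, W = ∑ j ∈ s, v j := ⟨_, rfl⟩
  rw [← hW]
  have hWk : 0 < W := hW ▸ Finset.sum_pos (fun j _ => hv j) hs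
  refine (measure_mono fun U hU => ?_).trans
    (measure_pi_sum_nonneg_le ν (f := fun u => ∑ j ∈ s, v j / W * (t * Z j u ^ 2) - 2)
      (by have := hZ; fun_prop) (c := 1) ?_ N)
  · replace hU : 2 / t * N * W < ∑ j ∈ s, v j * ∑ n, Z j (U n) ^ 2 := hU
    change 0 ≤ ∑ n, (∑ j ∈ s, v j / W * (t * Z j (U n) ^ 2) - 2)
    have e : ∑ n, (∑ j ∈ s, v j / W * (t * Z j (U n) ^ 2) - 2)
        = t / W * (∑ j ∈ s, v j * ∑ n, Z j (U n) ^ 2 - 2 / t * N * W) := by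
      simp only [Finset.sum_sub_distrib, Finset.sum_const, Finset.card_univ,
        Fintype.card_fin, nsmul_eq_mul]
      rw [Finset.sum_comm, mul_sub, Finset.mul_sum]
      congr 1
      · refine Finset.sum_congr rfl fun j _ => ?_
        rw [Finset.mul_sum, Finset.mul_sum]
        exact Finset.sum_congr rfl fun n _ => by ring
      · field_simp
    rw [e]
    exact mul_nonneg (by positivity) (by linarith)
  · have h1 := lintegral_exp_sum_le (P := ν) (Y := fun j u => t * Z j u ^ 2)
      (fun j => by have := hZ j; fun_prop) (M := 2)
      (fun j => by rw [ht]; exact lintegral_exp_sq_le (hZ j) hB (hsub j)) (s := s)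
      (p := fun j => v j / W) (fun j _ => (div_pos (hv j) hWk).le)
      (by rw [← Finset.sum_div, ← hW, div_self hWk.ne'])
    calc ∫⁻ u, ENNReal.ofReal (Real.exp (∑ j ∈ s, v j / W * (t * Z j u ^ 2) - 2)) ∂ν
        = ∫⁻ u, ENNReal.ofReal (Real.exp (-2)) * ENNReal.ofReal
            (Real.exp (∑ j ∈ s, v j / W * (t * Z j u ^ 2))) ∂ν := by
          refine lintegral_congr fun u => ?_
          rw [← ENNReal.ofReal_mul (Real.exp_pos _).le, ← Real.exp_add]
          congr 2; ring
      _ ≤ ENNReal.ofReal (Real.exp (-2)) * 2 := by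
          rw [lintegral_const_mul _ (by have := hZ; fun_prop)]
          gcongr
      _ ≤ ENNReal.ofReal (Real.exp (-1)) := by
          rw [show (2 : ℝ≥0∞) = ENNReal.ofReal 2 by simp,
            ← ENNReal.ofReal_mul (Real.exp_pos _).le]
          refine ENNReal.ofReal_le_ofReal ?_
          have h2 : (2 : ℝ) ≤ Real.exp 1 := by linarith [Real.add_one_le_exp 1]
          calc Real.exp (-2) * 2 ≤ Real.exp (-2) * Real.exp 1 := by gcongr
            _ = _ := by rw [← Real.exp_add]; norm_num

/-- Uniform concentration of the sums `∑ n, Z_j(u_n) ^ 2` for subgaussian `Z_j`: with exponentially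
high probability, the first `J ≤ N` sums are bounded below, and all the weighted tail sums are
bounded above. -/
theorem exists_concentration_event (ν : Measure X)
    [IsProbabilityMeasure ν] {Z : ℕ → X → ℝ} (hZ : ∀ j, Measurable (Z j))
    (hZ2 : ∀ j, ∫⁻ u, ENNReal.ofReal (Z j u ^ 2) ∂ν = 1) {B : ℝ} (hB : 0 < B)
    (hsub : ∀ j, psi2Norm (Z j) ν ≤ ENNReal.ofReal B) :
    ∃ c > 0, ∃ C > 0, ∃ A > 0, ∀ N J : ℕ, J ≤ N → ∀ (v : ℕ → ℝ) (V : ℝ), (∀ j, 0 < v j) →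
      (∀ k, ∑ j ∈ Finset.Ico J k, v j ≤ V) → ∃ E : Set (Fin N → X), MeasurableSet E ∧
        1 - C * Real.exp (-c * N) ≤ (Measure.pi fun _ : Fin N => ν).real E ∧
        ∀ U ∈ E, (∀ j < J, (N : ℝ) / 4 ≤ ∑ n, Z j (U n) ^ 2) ∧
          ∀ k, ∑ j ∈ Finset.Ico J k, v j * ∑ n, Z j (U n) ^ 2 ≤ A * N * V := by
  obtain ⟨c₁, hc₁0, hlow_le⟩ := exists_measure_sum_sq_le ν hZ hZ2 hB hsub
  obtain ⟨A, hA0, hhigh_le⟩ := exists_measure_weighted_sum_sq_le ν hZ hB hsub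
  obtain ⟨c, hc⟩ : ∃ c, c = min (c₁ / 2) 1 := ⟨_, rfl⟩
  have hc0 : 0 < c := by rw [hc]; positivity
  refine ⟨c, hc0, 2 / c₁ + 1, by positivity, A, hA0, fun N J hJ v V hv hV => ?_⟩
  set low : ℕ → Set (Fin N → X) := fun j => {U | ∑ n, Z j (U n) ^ 2 ≤ N / 4} with hlow
  set high : ℕ → Set (Fin N → X) := fun k =>
    {U | A * N * V < ∑ j ∈ Finset.Ico J k, v j * ∑ n, Z j (U n) ^ 2} with hhigh
  have hlow_meas : ∀ j, MeasurableSet (low j) := fun j => by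
    have := hZ j
    exact measurableSet_le (by fun_prop) measurable_const
  have hhigh_meas : MeasurableSet (⋃ k, high k) := by
    have := hZ
    exact MeasurableSet.iUnion fun k => measurableSet_lt measurable_const (by fun_prop)
  have hV0 : 0 ≤ V := (Finset.sum_nonneg fun j _ => (hv j).le).trans (hV 0)
  -- The bad events increase with `k`, so their union costs no more than the uniform bound for a
  -- single one.
  have hmono : Monotone high := fun k k' hkk' U (hU : _ < _) =>
    hU.trans_le <| Finset.sum_le_sum_of_subset_of_nonneg (Finset.Ico_subset_Ico_right hkk')
      fun j _ _ => mul_nonneg (hv j).le (Finset.sum_nonneg fun _ _ => sq_nonneg _)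
  have hU_le : (Measure.pi fun _ : Fin N => ν) (⋃ k, high k)
      ≤ ENNReal.ofReal (Real.exp (-1 * N)) := by
    rw [hmono.measure_iUnion]
    refine iSup_le fun k => ?_
    rcases le_or_gt k J with hk | hk
    · have : high k = ∅ := by
        ext U
        simp only [hhigh, Finset.Ico_eq_empty_of_le hk, Finset.sum_empty, Set.mem_ofPred_eq,
          Set.mem_empty_iff_false, iff_false, not_lt]
        positivity
      rw [this]; simp
    · refine (measure_mono fun U hU => ?_).trans
        (hhigh_le N v (Finset.Ico J k) hv ⟨J, by simp [hk]⟩)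
      replace hU : A * N * V < ∑ j ∈ Finset.Ico J k, v j * ∑ n, Z j (U n) ^ 2 := hU
      refine lt_of_le_of_lt ?_ hU
      exact mul_le_mul_of_nonneg_left (hV k) (by positivity)
  have hbad_meas : MeasurableSet ((⋃ j ∈ Finset.range J, low j) ∪ ⋃ k, high k) :=
    (Finset.measurableSet_biUnion _ fun j _ => hlow_meas j).union hhigh_meas
  refine ⟨((⋃ j ∈ Finset.range J, low j) ∪ ⋃ k, high k)ᶜ, hbad_meas.compl, ?_, fun U hU => ?_⟩
  · rw [probReal_compl_eq_one_sub hbad_meas]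
    have hbound : (Measure.pi fun _ : Fin N => ν).real
        ((⋃ j ∈ Finset.range J, low j) ∪ ⋃ k, high k)
        ≤ N * Real.exp (-c₁ * N) + Real.exp (-1 * N) := by
      refine ENNReal.toReal_le_of_le_ofReal (by positivity) ?_
      rw [ENNReal.ofReal_add (by positivity) (by positivity)]
      refine (measure_union_le _ _).trans (add_le_add ?_ hU_le)
      refine (measure_biUnion_finset_le _ _).trans ?_
      calc _ ≤ ∑ _j ∈ Finset.range J, ENNReal.ofReal (Real.exp (-c₁ * N)) :=
            Finset.sum_le_sum fun j _ => hlow_le N j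
        _ = J * ENNReal.ofReal (Real.exp (-c₁ * N)) := by simp
        _ ≤ N * ENNReal.ofReal (Real.exp (-c₁ * N)) := by gcongr
        _ = _ := by rw [ENNReal.ofReal_mul (Nat.cast_nonneg N), ENNReal.ofReal_natCast]
    have h1 := natCast_mul_exp_le hc₁0 N
    have h2 : Real.exp (-(c₁ / 2) * N) ≤ Real.exp (-c * N) := by
      have : c ≤ c₁ / 2 := hc ▸ min_le_left _ _
      gcongr
    have h3 : Real.exp (-1 * N) ≤ Real.exp (-c * N) := by
      have : c ≤ 1 := hc ▸ min_le_right _ _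
      gcongr
    have h4 : 2 / c₁ * Real.exp (-(c₁ / 2) * N) ≤ 2 / c₁ * Real.exp (-c * N) := by gcongr
    linarith
  · simp only [Set.mem_compl_iff, Set.mem_union, Set.mem_iUnion, not_or, not_exists] at hU
    exact ⟨fun j hj => (not_le.1 (hU.1 j (Finset.mem_range.2 hj))).le, fun k => not_lt.1 (hU.2 k)⟩

end Concentration

/-! ### The posterior mean -/

/-- Completing the square in `l`: prior times likelihood is a constant multiple of the Gaussian
density whose precision is the sum of the data and prior precisions. -/
lemma gaussianPDFReal_mul_exp {m : ℝ≥0} (hm : 0 < m) {N : ℕ} (x y : Fin N → ℝ) {v : ℝ≥0}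
    (hv : v = (∑ n, x n ^ 2 + (m : ℝ)⁻¹)⁻¹) :
    ∃ K > 0, ∀ l : ℝ, gaussianPDFReal 0 m l * Real.exp (-(∑ n, (y n - l * x n) ^ 2) / 2)
      = K * gaussianPDFReal (v * ∑ n, x n * y n) v l := by
  have hm' : (0 : ℝ) < m := hm
  have hS : 0 ≤ ∑ n, x n ^ 2 := Finset.sum_nonneg fun _ _ => sq_nonneg _
  have hD : 0 < ∑ n, x n ^ 2 + (m : ℝ)⁻¹ := by positivity
  have hv0 : (0 : ℝ) < v := by rw [hv]; exact inv_pos.2 hD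
  refine ⟨(Real.sqrt (2 * Real.pi * m))⁻¹ * Real.sqrt (2 * Real.pi * v)
    * Real.exp (-(∑ n, y n ^ 2) / 2 + v * (∑ n, x n * y n) ^ 2 / 2), by positivity, fun l => ?_⟩
  have hsq : ∑ n, (y n - l * x n) ^ 2
      = ∑ n, y n ^ 2 - 2 * l * ∑ n, x n * y n + l ^ 2 * ∑ n, x n ^ 2 := by
    rw [Finset.mul_sum, Finset.mul_sum, ← Finset.sum_sub_distrib, ← Finset.sum_add_distrib]
    exact Finset.sum_congr rfl fun n _ => by ring
  have hSv : ∑ n, x n ^ 2 = (v : ℝ)⁻¹ - (m : ℝ)⁻¹ := by rw [hv, inv_inv]; ring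
  rw [gaussianPDFReal, gaussianPDFReal, hsq, hSv]
  have hs : Real.sqrt (2 * Real.pi * v) ≠ 0 := by positivity
  have key : Real.exp (-(l - 0) ^ 2 / (2 * m)) * Real.exp (-(∑ n, y n ^ 2
      - 2 * l * ∑ n, x n * y n + l ^ 2 * ((v : ℝ)⁻¹ - (m : ℝ)⁻¹)) / 2)
      = Real.exp (-(∑ n, y n ^ 2) / 2 + v * (∑ n, x n * y n) ^ 2 / 2)
        * Real.exp (-(l - v * ∑ n, x n * y n) ^ 2 / (2 * v)) := by
    rw [← Real.exp_add, ← Real.exp_add]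
    congr 1
    field_simp
    ring
  rw [mul_assoc, key]
  field_simp

lemma integral_eigenvaluePosterior {m : ℝ≥0} (hm : 0 < m) {N : ℕ} (x y : Fin N → ℝ) :
    ∫ l, l ∂(eigenvaluePosterior m x y)
      = (∑ n, x n * y n) / (∑ n, x n ^ 2 + (m : ℝ)⁻¹) := by
  have hm' : (0 : ℝ) < m := hm
  have hS : 0 ≤ ∑ n, x n ^ 2 := Finset.sum_nonneg fun _ _ => sq_nonneg _
  have hD : 0 < ∑ n, x n ^ 2 + (m : ℝ)⁻¹ := by positivity
  obtain ⟨v, hv⟩ : ∃ v : ℝ≥0, (v : ℝ) = (∑ n, x n ^ 2 + (m : ℝ)⁻¹)⁻¹ :=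
    ⟨⟨_, (inv_pos.2 hD).le⟩, rfl⟩
  have hv0 : v ≠ 0 := by
    intro h
    rw [h] at hv
    exact (inv_pos.2 hD).ne hv
  obtain ⟨K, hK, hpdf⟩ := gaussianPDFReal_mul_exp hm x y hv
  have hZ : ∫ l, Real.exp (-(∑ n, (y n - l * x n) ^ 2) / 2) ∂(gaussianReal 0 m) = K := by
    rw [integral_gaussianReal_eq_integral_smul hm.ne']
    simp_rw [smul_eq_mul, hpdf]
    rw [integral_const_mul, integral_gaussianPDFReal_eq_one _ hv0, mul_one]
  rw [eigenvaluePosterior, integral_tilted, hZ, integral_gaussianReal_eq_integral_smul hm.ne']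
  have : ∀ l : ℝ, gaussianPDFReal 0 m l
      • (Real.exp (-(∑ n, (y n - l * x n) ^ 2) / 2) / K) • l
      = gaussianPDFReal (v * ∑ n, x n * y n) v l • l := by
    intro l
    simp only [smul_eq_mul]
    rw [← mul_assoc, mul_div_assoc', hpdf, mul_div_cancel_left₀ _ hK.ne']
  simp_rw [this]
  rw [← integral_gaussianReal_eq_integral_smul hv0, integral_id_gaussianReal, hv,
    inv_mul_eq_div]

section

variable {H : Type*} [NormedAddCommGroup H] [InnerProductSpace ℝ H]

lemma posteriorMean_eq (φ : HilbertBasis ℕ ℝ H) {μ : ℕ → ℝ≥0} (hμ : ∀ j, 0 < μ j) {N : ℕ}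
    (U : Fin N → H) (Y : Fin N → H → ℝ) (j : ℕ) :
    posteriorMean φ μ U Y j
      = (∑ n, ⟪φ j, U n⟫ * Y n (φ j)) / (∑ n, ⟪φ j, U n⟫ ^ 2 + (μ j : ℝ)⁻¹) := by
  rw [posteriorMean, posterior, ← integral_eigenvaluePosterior (hμ j),
    ← Measure.infinitePi_map_eval (fun j =>
      eigenvaluePosterior (μ j) (fun n => ⟪φ j, U n⟫) (fun n => Y n (φ j))) j,
    integral_map (measurable_pi_apply j).aemeasurable (by fun_prop)]

lemma observation_basis (φ : HilbertBasis ℕ ℝ H) (l : ℕ → ℝ) {u : H}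
    (hu : u ∈ (diagonalOperator φ l).domain) (η : H → ℝ) (j : ℕ) :
    observation (diagonalOperator φ l) u η (φ j) = l j * ⟪φ j, u⟫ + η (φ j) := by
  rw [observation, dif_pos hu, real_inner_comm, ← φ.repr_apply_apply]
  have : diagonalOperator φ l ⟨u, hu⟩ = φ.repr.symm ⟨fun i => l i * ⟪φ i, u⟫, hu⟩ := rfl
  rw [this, LinearIsometryEquiv.apply_symm_apply]

/-- Separates the error into shrinkage bias `l_j / μ_j` and a linear noise term, over a common
denominator that depends only on the inputs. -/
lemma posteriorMean_observation_sub (φ : HilbertBasis ℕ ℝ H) (l : ℕ → ℝ) {μ : ℕ → ℝ≥0}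
    (hμ : ∀ j, 0 < μ j) {N : ℕ} (U : Fin N → H)
    (hU : ∀ n, U n ∈ (diagonalOperator φ l).domain) (η : Fin N → H → ℝ) (j : ℕ) :
    l j - posteriorMean φ μ U (fun n => observation (diagonalOperator φ l) (U n) (η n)) j
      = (l j * (μ j : ℝ)⁻¹ + ∑ n, (-⟪φ j, U n⟫) * η n (φ j))
        / (∑ n, ⟪φ j, U n⟫ ^ 2 + (μ j : ℝ)⁻¹) := by
  have hm' : (0 : ℝ) < μ j := hμ j
  have hS : 0 ≤ ∑ n, ⟪φ j, U n⟫ ^ 2 := Finset.sum_nonneg fun _ _ => sq_nonneg _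
  have hD : 0 < ∑ n, ⟪φ j, U n⟫ ^ 2 + (μ j : ℝ)⁻¹ := by positivity
  rw [posteriorMean_eq φ hμ, eq_div_iff hD.ne', sub_mul, div_mul_cancel₀ _ hD.ne']
  simp_rw [observation_basis φ l (hU _), mul_add, Finset.sum_add_distrib, neg_mul,
    Finset.sum_neg_distrib]
  have : ∑ n, ⟪φ j, U n⟫ * (l j * ⟪φ j, U n⟫) = l j * ∑ n, ⟪φ j, U n⟫ ^ 2 := by
    rw [Finset.mul_sum]; exact Finset.sum_congr rfl fun n _ => by ring
  rw [this]
  ring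

end

/-! ### Second moments of the noise and the scalar risk. -/

lemma integral_add_sum_sq {Ω : Type*} [MeasurableSpace Ω] {P : Measure Ω} [IsProbabilityMeasure P]
    {N : ℕ} {ξ : Fin N → Ω → ℝ} (hξ : ∀ n, MemLp (ξ n) 2 P) (h1 : ∀ n, ∫ ω, ξ n ω ∂P = 0)
    (h2 : ∀ n k, ∫ ω, ξ n ω * ξ k ω ∂P = if n = k then 1 else 0) (b : ℝ) (x : Fin N → ℝ) :
    ∫ ω, (b + ∑ n, x n * ξ n ω) ^ 2 ∂P = b ^ 2 + ∑ n, x n ^ 2 := by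
  have e : ∀ ω, (b + ∑ n, x n * ξ n ω) ^ 2 = b ^ 2 + (∑ n, 2 * b * x n * ξ n ω
      + ∑ n, ∑ k, x n * x k * (ξ n ω * ξ k ω)) := by
    intro ω
    rw [add_sq, sq (∑ n, x n * ξ n ω), Finset.sum_mul_sum, add_assoc, Finset.mul_sum]
    congr 2
    · exact Finset.sum_congr rfl fun n _ => by ring
    · exact Finset.sum_congr rfl fun n _ => Finset.sum_congr rfl fun k _ => by ring
  have i1 : ∀ n, Integrable (fun ω => 2 * b * x n * ξ n ω) P := fun n =>
    ((hξ n).integrable one_le_two).const_mul _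
  have i2 : ∀ n k, Integrable (fun ω => x n * x k * (ξ n ω * ξ k ω)) P := fun n k =>
    ((hξ n).integrable_mul (hξ k)).const_mul _
  have i3 : Integrable (fun ω => ∑ n, 2 * b * x n * ξ n ω) P :=
    integrable_finsetSum _ fun n _ => i1 n
  have i4 : ∀ n, Integrable (fun ω => ∑ k, x n * x k * (ξ n ω * ξ k ω)) P := fun n =>
    integrable_finsetSum _ fun k _ => i2 n k
  have i5 : Integrable (fun ω => ∑ n, ∑ k, x n * x k * (ξ n ω * ξ k ω)) P :=
    integrable_finsetSum _ fun n _ => i4 n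
  have i6 : Integrable (fun ω => ∑ n, 2 * b * x n * ξ n ω
      + ∑ n, ∑ k, x n * x k * (ξ n ω * ξ k ω)) P := i3.add i5
  simp_rw [e]
  rw [integral_add (integrable_const _) i6, integral_add i3 i5,
    integral_finsetSum _ fun n _ => i1 n, integral_finsetSum _ fun n _ => i4 n]
  simp_rw [integral_finsetSum _ fun k _ => i2 _ k, integral_const_mul, h1, h2]
  simp [sq]

lemma integrable_add_sum_sq {Ω : Type*} [MeasurableSpace Ω] {P : Measure Ω}
    [IsProbabilityMeasure P] {N : ℕ} {ξ : Fin N → Ω → ℝ} (hξ : ∀ n, MemLp (ξ n) 2 P) (b : ℝ)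
    (x : Fin N → ℝ) : Integrable (fun ω => (b + ∑ n, x n * ξ n ω) ^ 2) P :=
  ((memLp_const b).add (memLp_finsetSum _ fun n _ => (hξ n).const_mul (x n))).integrable_sq

section Noise

variable {H : Type*} [NormedAddCommGroup H] [InnerProductSpace ℝ H] {Ω : Type*}
  [MeasurableSpace Ω] {P : Measure Ω}

lemma IsWhiteNoise.memLp {η : H → Ω → ℝ} (hη : IsWhiteNoise η P) (h : H) : MemLp (η h) 2 P :=
  (hη.isGaussianProcess.hasGaussianLaw_eval h).memLp_two

variable {η : ℕ → H → Ω → ℝ}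

lemma integral_noise_mul (hη : ∀ n, IsWhiteNoise (η n) P)
    (hind : iIndepFun (fun n ω h => η n h ω) P) {h : H} (hh : ‖h‖ = 1) (n k : ℕ) :
    ∫ ω, η n h ω * η k h ω ∂P = if n = k then 1 else 0 := by
  split_ifs with hnk
  · subst hnk
    rw [(hη n).cov_eq, real_inner_self_eq_norm_sq, hh, one_pow]
  · have hi : IndepFun (η n h) (η k h) P :=
      (hind.indepFun hnk).comp (measurable_pi_apply h) (measurable_pi_apply h)
    have := hi.integral_mul_eq_mul_integral ((hη n).memLp h).1 ((hη k).memLp h).1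
    simpa [(hη n).mean_eq_zero] using this

variable [IsProbabilityMeasure P]

lemma lintegral_posteriorMean_sub_sq (φ : HilbertBasis ℕ ℝ H) (l : ℕ → ℝ) {μ : ℕ → ℝ≥0}
    (hμ : ∀ j, 0 < μ j) (hη : ∀ n, IsWhiteNoise (η n) P)
    (hind : iIndepFun (fun n ω h => η n h ω) P) {N : ℕ} (U : Fin N → H)
    (hU : ∀ n, U n ∈ (diagonalOperator φ l).domain) (j : ℕ) {w : ℝ} (hw : 0 ≤ w) :
    ∫⁻ ω, ENNReal.ofReal (w * (l j - posteriorMean φ μ U (fun n =>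
        observation (diagonalOperator φ l) (U n) fun h => η n h ω) j) ^ 2) ∂P
      = ENNReal.ofReal (w * ridgeRisk (l j) (μ j) (∑ n, ⟪φ j, U n⟫ ^ 2)) := by
  simp_rw [posteriorMean_observation_sub φ l hμ U hU, div_pow]
  have hφ : ‖φ j‖ = 1 := φ.orthonormal.1 j
  have hξ : ∀ n : Fin N, MemLp (η n (φ j)) 2 P := fun n => (hη n).memLp _
  rw [← ofReal_integral_eq_lintegral_ofReal
    (((integrable_add_sum_sq hξ _ _).div_const _).const_mul _)
    (ae_of_all _ fun ω => by positivity), integral_const_mul, integral_div,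
    integral_add_sum_sq hξ (fun n => (hη n).mean_eq_zero _)
      (fun n k => by rw [integral_noise_mul hη hind hφ]; simp [Fin.ext_iff])]
  simp_rw [neg_sq]
  rw [mul_pow, ridgeRisk]

lemma aemeasurable_posteriorMean_sub_sq (φ : HilbertBasis ℕ ℝ H) (l : ℕ → ℝ) {μ : ℕ → ℝ≥0}
    (hμ : ∀ j, 0 < μ j) (hη : ∀ n, IsWhiteNoise (η n) P) {N : ℕ} (U : Fin N → H)
    (hU : ∀ n, U n ∈ (diagonalOperator φ l).domain) (j : ℕ) (w : ℝ) :
    AEMeasurable (fun ω => ENNReal.ofReal (w * (l j - posteriorMean φ μ U (fun n =>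
        observation (diagonalOperator φ l) (U n) fun h => η n h ω) j) ^ 2)) P := by
  simp_rw [posteriorMean_observation_sub φ l hμ U hU, div_pow]
  have hξ : ∀ n : Fin N, MemLp (η n (φ j)) 2 P := fun n => (hη n).memLp _
  exact (((integrable_add_sum_sq hξ _ _).div_const _).const_mul _).1.aemeasurable.ennreal_ofReal

end Noise

/-! ### The test error -/

section

variable {H : Type*} [NormedAddCommGroup H] [InnerProductSpace ℝ H]

lemma composition_basis (φ : HilbertBasis ℕ ℝ H) (l : ℕ → ℝ) (q : H →ₗ.[ℝ] ℝ)
    (hq : ∀ j, φ j ∈ q.domain) (j : ℕ)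
    (h : φ j ∈ (composition q (diagonalOperator φ l)).domain) :
    composition q (diagonalOperator φ l) ⟨φ j, h⟩ = l j * q ⟨φ j, hq j⟩ := by
  have h1 : l j • φ j ∈ q.domain := Submodule.smul_mem _ _ (hq j)
  -- Generalizing over `y` allows substitution in spite of the membership proof attached to it.
  have h2 : ∀ y (hy : y ∈ q.domain), y = l j • φ j → q ⟨y, hy⟩ = l j * q ⟨φ j, hq j⟩ := by
    rintro y hy rfl
    have : (⟨l j • φ j, hy⟩ : q.domain) = l j • ⟨φ j, hq j⟩ := rfl
    rw [this, LinearPMap.map_smul, smul_eq_mul]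
  exact h2 _ _ (diagonalOperator_basis φ l j)

lemma composition_partialSum (φ : HilbertBasis ℕ ℝ H) (l : ℕ → ℝ) (q : H →ₗ.[ℝ] ℝ)
    (hq : ∀ j, φ j ∈ q.domain) (n : ℕ) (x : ℕ → ℝ) :
    composition q (diagonalOperator φ l) ⟨partialSum φ n x, partialSum_mem_domain φ l q hq n x⟩
      = ∑ j ∈ Finset.range n, l j * q ⟨φ j, hq j⟩ * x j := by
  -- Each basis vector is the difference of two consecutive partial sums of the constant sequence
  -- `1`.
  have hφ : ∀ j, φ j ∈ (composition q (diagonalOperator φ l)).domain := fun j => by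
    simpa [partialSum, Finset.sum_range_succ] using
      (Submodule.sub_mem _ (partialSum_mem_domain φ l q hq (j + 1) 1)
        (partialSum_mem_domain φ l q hq j 1))
  induction n with
  | zero =>
    rw [Finset.range_zero, Finset.sum_empty]
    exact LinearPMap.map_zero _
  | succ n ih =>
    have : (⟨partialSum φ (n + 1) x, partialSum_mem_domain φ l q hq (n + 1) x⟩ :
        (composition q (diagonalOperator φ l)).domain)
        = ⟨partialSum φ n x, partialSum_mem_domain φ l q hq n x⟩ + x n • ⟨φ n, hφ n⟩ :=
      Subtype.ext (Finset.sum_range_succ _ _)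
    rw [this, LinearPMap.map_add, LinearPMap.map_smul, ih, composition_basis φ l q hq,
      Finset.sum_range_succ, smul_eq_mul, mul_comm (x n)]

end

/-! ### Orthogonal series with squared norms `s j`, possibly zero. -/

section OrthogonalSeries

variable {E : Type*} [NormedAddCommGroup E] [InnerProductSpace ℝ E] {e : ℕ → E} {s : ℕ → ℝ}

lemma norm_sum_smul_sq (he : ∀ j k, ⟪e j, e k⟫ = if j = k then s j else 0) (c : ℕ → ℝ)
    (t : Finset ℕ) : ‖∑ j ∈ t, c j • e j‖ ^ 2 = ∑ j ∈ t, s j * c j ^ 2 := by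
  rw [← real_inner_self_eq_norm_sq, sum_inner]
  refine Finset.sum_congr rfl fun j hj => ?_
  simp_rw [inner_sum, real_inner_smul_left, real_inner_smul_right, he]
  rw [Finset.sum_eq_single_of_mem j hj fun k _ hk => by simp [hk.symm]]
  simp only [if_true]
  ring

lemma summable_smul [CompleteSpace E] (he : ∀ j k, ⟪e j, e k⟫ = if j = k then s j else 0)
    {c : ℕ → ℝ} (hc : Summable fun j => s j * c j ^ 2) : Summable fun j => c j • e j := by
  rw [summable_iff_vanishing_norm] at hc ⊢
  intro ε hε
  obtain ⟨t, ht⟩ := hc (ε ^ 2) (by positivity)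
  refine ⟨t, fun t' ht' => ?_⟩
  have := (le_abs_self _).trans_lt (ht t' ht')
  rw [← norm_sum_smul_sq he] at this
  exact lt_of_pow_lt_pow_left₀ 2 hε.le this

lemma norm_tsum_smul_sq [CompleteSpace E] (he : ∀ j k, ⟪e j, e k⟫ = if j = k then s j else 0)
    {c : ℕ → ℝ} (hc : Summable fun j => s j * c j ^ 2) :
    ‖∑' j, c j • e j‖ ^ 2 = ∑' j, s j * c j ^ 2 := by
  have h1 := ((summable_smul he hc).hasSum.tendsto_sum_nat.norm).pow 2
  simp_rw [norm_sum_smul_sq he] at h1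
  exact tendsto_nhds_unique h1 hc.hasSum.tendsto_sum_nat

end OrthogonalSeries

/-! ### Test coordinates as an orthogonal family in `L²(ν')`. -/

section

variable {H : Type*} [NormedAddCommGroup H] [InnerProductSpace ℝ H] {ν' : Measure (ℕ → ℝ)}
  {σ' : ℕ → ℝ} {α' : ℝ}

lemma IsTestInput.nonneg (hν' : IsTestInput ν' σ' α') (j : ℕ) : 0 ≤ σ' j := by
  have := hν'.cov_eq j j
  rw [if_pos rfl] at this
  rw [← this]
  exact integral_nonneg fun x => mul_self_nonneg _

/-- The coordinate functions as elements of `L²`. -/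
noncomputable def IsTestInput.coord (hν' : IsTestInput ν' σ' α') (j : ℕ) : Lp ℝ 2 ν' :=
  (hν'.memLp j).toLp _

lemma IsTestInput.inner_coord (hν' : IsTestInput ν' σ' α') (j k : ℕ) :
    ⟪hν'.coord j, hν'.coord k⟫ = if j = k then σ' j else 0 := by
  rw [← hν'.cov_eq, L2.inner_def]
  refine integral_congr_ae ?_
  filter_upwards [(hν'.memLp j).coeFn_toLp, (hν'.memLp k).coeFn_toLp] with x hj hk
  rw [IsTestInput.coord, IsTestInput.coord, hj, hk]
  simp [mul_comm]

lemma IsTestInput.coeFn_sum_coord (hν' : IsTestInput ν' σ' α') (c : ℕ → ℝ) (n : ℕ) :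
    (∑ j ∈ Finset.range n, c j • hν'.coord j : Lp ℝ 2 ν')
      =ᵐ[ν'] fun x => ∑ j ∈ Finset.range n, c j * x j := by
  induction n with
  | zero =>
    simp only [Finset.range_zero, Finset.sum_empty]
    exact Lp.coeFn_zero ℝ 2 ν'
  | succ n ih =>
    rw [Finset.sum_range_succ]
    filter_upwards [ih, Lp.coeFn_add (∑ j ∈ Finset.range n, c j • hν'.coord j)
      (c n • hν'.coord n), Lp.coeFn_smul (c n) (hν'.coord n), (hν'.memLp n).coeFn_toLp]
      with x h1 h2 h3 h4
    rw [h2, Pi.add_apply, h1, h3, Pi.smul_apply, IsTestInput.coord, h4, Finset.sum_range_succ,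
      smul_eq_mul]

lemma IsTestInput.isPtOMap (hν' : IsTestInput ν' σ' α') (φ : HilbertBasis ℕ ℝ H)
    (q : H →ₗ.[ℝ] ℝ) (hq : ∀ j, φ j ∈ q.domain) {l : ℕ → ℝ}
    (hl : Summable fun j => σ' j * (l j * q ⟨φ j, hq j⟩) ^ 2) :
    IsPtOMap φ ν' q hq l
      ((∑' j, (l j * q ⟨φ j, hq j⟩) • hν'.coord j : Lp ℝ 2 ν') : (ℕ → ℝ) → ℝ) where
  memLp := Lp.memLp _
  tendsto := by
    have h1 := (summable_smul hν'.inner_coord hl).hasSum.tendsto_sum_nat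
    have h2 := (tendsto_const_nhds (x := ∑' j, (l j * q ⟨φ j, hq j⟩) • hν'.coord j)).sub h1
    rw [sub_self] at h2
    have h3 := h2.enorm
    rw [enorm_zero] at h3
    refine h3.congr fun n => ?_
    rw [Lp.enorm_def]
    refine eLpNorm_congr_ae ?_
    filter_upwards [Lp.coeFn_sub (∑' j, (l j * q ⟨φ j, hq j⟩) • hν'.coord j)
      (∑ j ∈ Finset.range n, (l j * q ⟨φ j, hq j⟩) • hν'.coord j),
      hν'.coeFn_sum_coord (fun j => l j * q ⟨φ j, hq j⟩) n] with x h4 h5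
    rw [h4, Pi.sub_apply, h5, composition_partialSum]

/-- If the right side is finite, the series for the estimator converges because those for the truth
and for the difference do. Both maps then exist in `L²(ν')`, and Parseval's identity evaluates their
distance. -/
lemma IsTestInput.testError_le (hν' : IsTestInput ν' σ' α') (φ : HilbertBasis ℕ ℝ H)
    (q : H →ₗ.[ℝ] ℝ) (hq : ∀ j, φ j ∈ q.domain) {l : ℕ → ℝ}
    (hl : Summable fun j => σ' j * (l j * q ⟨φ j, hq j⟩) ^ 2) (lhat : ℕ → ℝ) :
    testError φ ν' q hq l lhat
      ≤ ∑' j, ENNReal.ofReal (σ' j * q ⟨φ j, hq j⟩ ^ 2 * (l j - lhat j) ^ 2) := by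
  by_cases htop : ∑' j, ENNReal.ofReal (σ' j * q ⟨φ j, hq j⟩ ^ 2 * (l j - lhat j) ^ 2) = ∞
  · rw [htop]; exact le_top
  have hσ := hν'.nonneg
  have hnn : ∀ j, 0 ≤ σ' j * q ⟨φ j, hq j⟩ ^ 2 * (l j - lhat j) ^ 2 := fun j =>
    mul_nonneg (mul_nonneg (hσ j) (sq_nonneg _)) (sq_nonneg _)
  have hd0 : Summable fun j => σ' j * q ⟨φ j, hq j⟩ ^ 2 * (l j - lhat j) ^ 2 := by
    have := ENNReal.summable_toReal htop
    simpa only [ENNReal.toReal_ofReal (hnn _)] using this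
  have hd : Summable fun j => σ' j * (l j * q ⟨φ j, hq j⟩ - lhat j * q ⟨φ j, hq j⟩) ^ 2 :=
    hd0.congr fun j => by ring
  have hlhat : Summable fun j => σ' j * (lhat j * q ⟨φ j, hq j⟩) ^ 2 := by
    refine Summable.of_nonneg_of_le (fun j => mul_nonneg (hσ j) (sq_nonneg _)) (fun j => ?_)
      ((hl.add hd).mul_left 2)
    have := hσ j
    -- This is `b² ≤ 2(a² + (a-b)²)`, whose defect is `(2a - b)²`.
    nlinarith [mul_nonneg this (sq_nonneg (2 * (l j * q ⟨φ j, hq j⟩) - lhat j * q ⟨φ j, hq j⟩))]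
  refine (iInf₂_le_of_le _ _ (iInf₂_le (hν'.isPtOMap φ q hq hl)
    (hν'.isPtOMap φ q hq hlhat))).trans (le_of_eq ?_)
  set G := ∑' j, (l j * q ⟨φ j, hq j⟩) • hν'.coord j with hG
  set Ghat := ∑' j, (lhat j * q ⟨φ j, hq j⟩) • hν'.coord j with hGhat
  have hsub : G - Ghat
      = ∑' j, (l j * q ⟨φ j, hq j⟩ - lhat j * q ⟨φ j, hq j⟩) • hν'.coord j := by
    rw [hG, hGhat, ← (summable_smul hν'.inner_coord hl).tsum_sub
      (summable_smul hν'.inner_coord hlhat)]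
    simp_rw [sub_smul]
  have hint : ∫⁻ x, ENNReal.ofReal (|G x - Ghat x| ^ 2) ∂ν' = ‖G - Ghat‖ₑ ^ 2 := by
    rw [Lp.enorm_def, eLpNorm_eq_lintegral_rpow_enorm_toReal (by simp) (by simp),
      ← ENNReal.rpow_natCast, ← ENNReal.rpow_mul]
    simp only [ENNReal.toReal_ofNat, Nat.cast_ofNat, one_div, ne_eq, OfNat.ofNat_ne_zero,
      not_false_eq_true, inv_mul_cancel₀, ENNReal.rpow_one, ENNReal.rpow_ofNat]
    refine lintegral_congr_ae ?_
    filter_upwards [Lp.coeFn_sub G Ghat] with x hx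
    rw [hx, Pi.sub_apply, Real.enorm_eq_ofReal_abs, ENNReal.ofReal_pow (abs_nonneg _)]
  rw [hint, ← ofReal_norm, ← ENNReal.ofReal_pow (norm_nonneg _), hsub,
    norm_tsum_smul_sq hν'.inner_coord hd, ← ENNReal.ofReal_tsum_of_nonneg hnn hd0]
  congr 1
  exact tsum_congr fun j => by ring

end

lemma mem_domain_of_tsum_ne_top {H : Type*} [NormedAddCommGroup H] [InnerProductSpace ℝ H]
    {φ : HilbertBasis ℕ ℝ H} {l : ℕ → ℝ} {u : H}
    (hu : ∑' j, ENNReal.ofReal (l j ^ 2 * ⟪φ j, u⟫ ^ 2) ≠ ∞) :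
    u ∈ (diagonalOperator φ l).domain := by
  change Memℓp (fun j => l j * ⟪φ j, u⟫) 2
  refine memℓp_gen ?_
  have h := ENNReal.summable_toReal hu
  refine h.congr fun j => ?_
  rw [ENNReal.toReal_ofReal (by positivity), Real.norm_eq_abs, ENNReal.toReal_ofNat,
    Real.rpow_two, sq_abs, mul_pow]

/-! ### Moments of the training inputs and the domain of the operator. -/

section TrainingInput

variable {H : Type*} [NormedAddCommGroup H] [InnerProductSpace ℝ H] [CompleteSpace H]
  [MeasurableSpace H] [BorelSpace H] {φ : HilbertBasis ℕ ℝ H} {ν : Measure H} {σ : ℕ → ℝ} {α : ℝ}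

lemma IsTrainingInput.integral_inner_sq (hν : IsTrainingInput φ ν σ α) (j : ℕ) :
    ∫ u, ⟪φ j, u⟫ ^ 2 ∂ν = σ j := by
  have h := covarianceOperator_inner hν.memLp (φ j) (φ j)
  rw [hν.cov_eq, real_inner_smul_left, real_inner_self_eq_norm_sq, φ.orthonormal.1 j] at h
  simp_rw [sq]
  rw [← h]; ring

lemma IsTrainingInput.integrable_inner_sq (hν : IsTrainingInput φ ν σ α) (j : ℕ) :
    Integrable (fun u => ⟪φ j, u⟫ ^ 2) ν :=
  (hν.memLp.const_inner (φ j)).integrable_sq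

lemma IsTrainingInput.lintegral_inner_sq (hν : IsTrainingInput φ ν σ α) (j : ℕ) :
    ∫⁻ u, ENNReal.ofReal (⟪φ j, u⟫ ^ 2) ∂ν = ENNReal.ofReal (σ j) := by
  rw [← hν.integral_inner_sq j]
  exact (ofReal_integral_eq_lintegral_ofReal (hν.integrable_inner_sq j)
    (ae_of_all _ fun u => sq_nonneg _)).symm

/-- The two-sided decay gives nonzero variances at arbitrarily large indices, and monotonicity
carries positivity back to every index. -/
lemma IsTrainingInput.pos (hν : IsTrainingInput φ ν σ α) (j : ℕ) : 0 < σ j := by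
  have hnn : ∀ k, 0 ≤ σ k := fun k =>
    hν.integral_inner_sq k ▸ integral_nonneg fun u => sq_nonneg _
  obtain ⟨C, hC⟩ := hν.decay.2.bound
  obtain ⟨k, hkj, hk⟩ := ((eventually_ge_atTop j).and hC).exists
  refine lt_of_lt_of_le (lt_of_le_of_ne (hnn k) fun h0 => ?_) (hν.antitone hkj)
  rw [← h0, norm_zero, mul_zero, norm_le_zero_iff] at hk
  exact (powerLaw_pos _ k).ne' hk

lemma IsTrainingInput.lintegral_coeff_sq (hν : IsTrainingInput φ ν σ α) (j : ℕ) :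
    ∫⁻ u, ENNReal.ofReal ((⟪φ j, u⟫ / Real.sqrt (σ j)) ^ 2) ∂ν = 1 := by
  have hσ := hν.pos j
  simp_rw [div_pow, Real.sq_sqrt hσ.le, div_eq_inv_mul, ENNReal.ofReal_mul (inv_pos.2 hσ).le]
  rw [lintegral_const_mul _ (by fun_prop), hν.lintegral_inner_sq,
    ← ENNReal.ofReal_mul (inv_pos.2 hσ).le, inv_mul_cancel₀ hσ.ne', ENNReal.ofReal_one]

lemma IsTrainingInput.exists_psi2Norm_le (hν : IsTrainingInput φ ν σ α) :
    ∃ B > 0, ∀ j, psi2Norm (fun u : H => ⟪φ j, u⟫ / Real.sqrt (σ j)) ν ≤ ENNReal.ofReal B := by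
  refine ⟨(⨆ j, psi2Norm (fun u : H => ⟪φ j, u⟫ / Real.sqrt (σ j)) ν).toReal + 1,
    add_pos_of_nonneg_of_pos ENNReal.toReal_nonneg one_pos, fun j => ?_⟩
  refine (le_iSup (fun j => psi2Norm (fun u : H => ⟪φ j, u⟫ / Real.sqrt (σ j)) ν) j).trans ?_
  exact (ENNReal.ofReal_toReal hν.subgaussian.ne).symm.le.trans
    (ENNReal.ofReal_le_ofReal (le_add_of_nonneg_right zero_le_one))

/-- The expected sum is `∑ l_j² σ_j`, finite because `-2α ≤ 2β`. Thus almost every input lies in the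
domain of the operator, where `observation` does not take its default value. -/
lemma IsTrainingInput.ae_tsum_ne_top (hν : IsTrainingInput φ ν σ α) {β : ℝ} (hαβ : 0 < α + β)
    {l : ℕ → ℝ} (hl : MemSobolev β l) :
    ∀ᵐ u ∂ν, ∑' j, ENNReal.ofReal (l j ^ 2 * ⟪φ j, u⟫ ^ 2) ≠ ∞ := by
  obtain ⟨C, hC, hσ⟩ := exists_le_mul_powerLaw hν.decay.1
  have hσ0 := hν.pos
  have hsum : Summable fun j => l j ^ 2 * σ j := by
    refine Summable.of_nonneg_of_le (fun j => mul_nonneg (sq_nonneg _) (hσ0 j).le) (fun j => ?_)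
      (hl.mul_left C)
    have hp : powerLaw (-2 * α) j ≤ powerLaw (2 * β) j :=
      Real.rpow_le_rpow_of_exponent_le (by linarith [(Nat.cast_nonneg j : (0 : ℝ) ≤ j)])
        (by linarith)
    rw [sq_abs]
    calc l j ^ 2 * σ j ≤ l j ^ 2 * (C * powerLaw (2 * β) j) := by
          gcongr
          exact (hσ j).trans (by gcongr)
      _ = _ := by ring
  have hlin : ∫⁻ u, ∑' j, ENNReal.ofReal (l j ^ 2 * ⟪φ j, u⟫ ^ 2) ∂ν
      = ENNReal.ofReal (∑' j, l j ^ 2 * σ j) := by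
    rw [lintegral_tsum fun j => by fun_prop,
      ENNReal.ofReal_tsum_of_nonneg (fun j => mul_nonneg (sq_nonneg _) (hσ0 j).le) hsum]
    refine tsum_congr fun j => ?_
    simp_rw [ENNReal.ofReal_mul (sq_nonneg (l j))]
    rw [lintegral_const_mul _ (by fun_prop), hν.lintegral_inner_sq]
  filter_upwards [ae_lt_top (by fun_prop) (hlin ▸ ENNReal.ofReal_ne_top)] with u hu using hu.ne

end TrainingInput

/-! ### Assembly of the bound. -/

lemma expectedTestError_le {H : Type*} [NormedAddCommGroup H] [InnerProductSpace ℝ H]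
    (φ : HilbertBasis ℕ ℝ H) {ν' : Measure (ℕ → ℝ)} {σ' : ℕ → ℝ} {α' : ℝ}
    (hν' : IsTestInput ν' σ' α') (q : H →ₗ.[ℝ] ℝ) (hq : ∀ j, φ j ∈ q.domain) {l : ℕ → ℝ}
    (hl : Summable fun j => σ' j * (l j * q ⟨φ j, hq j⟩) ^ 2) {μ : ℕ → ℝ≥0} (hμ : ∀ j, 0 < μ j)
    {Ω : Type*} [MeasurableSpace Ω] {P : Measure Ω} [IsProbabilityMeasure P]
    {η : ℕ → H → Ω → ℝ} (hη : ∀ n, IsWhiteNoise (η n) P)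
    (hind : iIndepFun (fun n ω h => η n h ω) P) {N : ℕ} (U : Fin N → H)
    (hU : ∀ n, U n ∈ (diagonalOperator φ l).domain) :
    expectedTestError φ ν' q hq l μ P η U
      ≤ ∑' j, ENNReal.ofReal (σ' j * q ⟨φ j, hq j⟩ ^ 2
        * ridgeRisk (l j) (μ j) (∑ n, ⟪φ j, U n⟫ ^ 2)) := by
  have hw : ∀ j, 0 ≤ σ' j * q ⟨φ j, hq j⟩ ^ 2 := fun j =>
    mul_nonneg (hν'.nonneg j) (sq_nonneg _)
  calc _ ≤ ∫⁻ ω, ∑' j, ENNReal.ofReal (σ' j * q ⟨φ j, hq j⟩ ^ 2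
          * (l j - posteriorMean φ μ U (fun n =>
            observation (diagonalOperator φ l) (U n) fun h => η n h ω) j) ^ 2) ∂P :=
        lintegral_mono fun ω => hν'.testError_le φ q hq hl _
    _ = _ := by
        rw [lintegral_tsum fun j => aemeasurable_posteriorMean_sub_sq φ l hμ hη U hU j _]
        exact tsum_congr fun j => lintegral_posteriorMean_sub_sq φ l hμ hη hind U hU j (hw j)

end FullField

theorem mainTheorem2 {H : Type*} [NormedAddCommGroup H] [InnerProductSpace ℝ H] [CompleteSpace H]
    [MeasurableSpace H] [BorelSpace H]
    (φ : HilbertBasis ℕ ℝ H)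
    (α α' β r : ℝ) (hα : 1 / 2 < α) (hα' : 0 ≤ α')
    (hexp : 0 < min α (α' + r + 1 / 2) + β)
    (ν : Measure H) [IsProbabilityMeasure ν] (σ : ℕ → ℝ) (hν : IsTrainingInput φ ν σ α)
    (ν' : Measure (ℕ → ℝ)) [IsProbabilityMeasure ν'] (σ' : ℕ → ℝ) (hν' : IsTestInput ν' σ' α')
    (l : ℕ → ℝ) (hl : MemSobolev β l)
    (μ : ℕ → ℝ≥0) (hμ_pos : ∀ j, 0 < μ j)
    (hμ : (fun j => (μ j : ℝ)) =Θ[atTop] powerLaw (-2 * β - 1))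
    (q : H →ₗ.[ℝ] ℝ) (hq : ∀ j, φ j ∈ q.domain)
    (hq_decay : (fun j => |q ⟨φ j, hq j⟩| ^ 2) =O[atTop] powerLaw (-2 * r - 1))
    (hql : Summable fun j => |q ⟨φ j, hq j⟩| ^ 2 * |l j| ^ 2)
    {Ω : Type*} [MeasurableSpace Ω] (P : Measure Ω) [IsProbabilityMeasure P]
    (η : ℕ → H → Ω → ℝ) (hη : ∀ n, IsWhiteNoise (η n) P)
    (hη_indep : iIndepFun (fun n ω h => η n h ω) P) :
    ∃ c > 0, ∃ C > 0, ∃ K > 0, ∃ N₀ : ℕ, ∀ N ≥ N₀,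
      ∃ E : Set (Fin N → H), MeasurableSet E ∧
        1 - C * Real.exp (-c * N) ≤ (Measure.pi fun _ : Fin N => ν).real E ∧
        ∀ U ∈ E, expectedTestError φ ν' q hq l μ P η U
          ≤ ENNReal.ofReal (K * rate α α' β r N) := by
  have hαβ : 0 < α + β := hexp.trans_le (by gcongr; exact min_le_left _ _)
  have hαrβ : 0 < α' + r + 1 / 2 + β := hexp.trans_le (by gcongr; exact min_le_right _ _)
  have hσ0 := hν.pos
  obtain ⟨Cσ, hCσ, hσ⟩ := exists_le_mul_powerLaw hν.decay.1
  obtain ⟨cσ, hcσ, hσ'⟩ := exists_mul_powerLaw_le hν.decay.2 hσ0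
  obtain ⟨Cm, hCm, hm⟩ := exists_le_mul_powerLaw hμ.1
  obtain ⟨cm, hcm, hm'⟩ := exists_mul_powerLaw_le hμ.2 fun j => by exact_mod_cast hμ_pos j
  obtain ⟨C₁, hC₁, hσ''⟩ := exists_le_mul_powerLaw hν'.decay
  obtain ⟨C₂, hC₂, hqb⟩ := exists_le_mul_powerLaw hq_decay
  have hw0 : ∀ j, 0 ≤ σ' j * q ⟨φ j, hq j⟩ ^ 2 := fun j =>
    mul_nonneg (hν'.nonneg j) (sq_nonneg _)
  have hw : ∀ j, σ' j * q ⟨φ j, hq j⟩ ^ 2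
      ≤ C₁ * C₂ * powerLaw (-(1 + 2 * α' + 2 * r)) j := fun j => by
    have e : powerLaw (-(1 + 2 * α' + 2 * r)) j
        = powerLaw (-2 * α') j * powerLaw (-2 * r - 1) j := by
      rw [← powerLaw_add]; congr 1; ring
    have h1 := hσ'' j
    have h2 := hqb j
    rw [sq_abs] at h2
    have h3 := powerLaw_pos (-2 * α') j
    calc _ ≤ (C₁ * powerLaw (-2 * α') j) * (C₂ * powerLaw (-2 * r - 1) j) := by gcongr
      _ = _ := by rw [e]; ring
  have hlq : Summable fun j => σ' j * (l j * q ⟨φ j, hq j⟩) ^ 2 := by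
    refine Summable.of_nonneg_of_le (fun j => mul_nonneg (hν'.nonneg j) (sq_nonneg _))
      (fun j => ?_) (hql.mul_left C₁)
    -- Boundedness of the test variances comes from `α' ≥ 0`; continuity of `q ∘ L` then gives
    -- square integrability.
    have h1 : σ' j ≤ C₁ := (hσ'' j).trans <| mul_le_of_le_one_right hC₁.le <|
      Real.rpow_le_one_of_one_le_of_nonpos (by linarith [(Nat.cast_nonneg j : (0 : ℝ) ≤ j)])
        (by linarith)
    rw [sq_abs, sq_abs, ← mul_pow, mul_comm (q _)]
    gcongr
  obtain ⟨B, hB, hsub⟩ := hν.exists_psi2Norm_le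
  obtain ⟨c, hc, C, hC, A, hA, hconc⟩ := exists_concentration_event ν
    (Z := fun j (u : H) => ⟪φ j, u⟫ / Real.sqrt (σ j)) (fun j => by fun_prop)
    hν.lintegral_coeff_sq hB hsub
  obtain ⟨K, hK, hrisk⟩ := exists_weighted_risk_le_rate (r := r) (α' := α') hαβ (by linarith)
    (mul_pos hC₁ hC₂) hCσ hcσ hCm hcm hw0 hw hl hσ hσ' hm hm' hA
  refine ⟨c, hc, C, hC, K, hK, 3, fun N hN => ?_⟩
  have hN1 : (1 : ℝ) ≤ N := by exact_mod_cast (by omega : 1 ≤ N)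
  have hJ0 : 0 < ⌊(N : ℝ) ^ (1 / (1 + 2 * α + 2 * β))⌋₊ :=
    Nat.floor_pos.2 (Real.one_le_rpow hN1 (one_div_nonneg.2 (by linarith)))
  have hJN : ⌊(N : ℝ) ^ (1 / (1 + 2 * α + 2 * β))⌋₊ ≤ N := by
    refine Nat.floor_le_of_le ?_
    conv_rhs => rw [← Real.rpow_one (N : ℝ)]
    refine Real.rpow_le_rpow_of_exponent_le hN1 ?_
    rw [div_le_one (by linarith)]
    linarith
  have hs0 : 0 < 2 + 2 * α + 4 * β + 2 * α' + 2 * r := by linarith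
  -- The weights have the order of the upper bound for `w_j μ_j² σ_j`, and `V` is the telescoped
  -- bound on their tail sums from `J`.
  obtain ⟨E, hE, hEp, hEU⟩ := hconc N _ hJN _ _ (powerLaw_pos _) (sum_Ico_powerLaw_le hs0 hJ0)
  set D : Set H := {u | ∑' j, ENNReal.ofReal (l j ^ 2 * ⟪φ j, u⟫ ^ 2) ≠ ∞} with hD
  have hDm : MeasurableSet D :=
    (measurableSet_singleton ∞).compl.preimage (Measurable.tsum fun j => by fun_prop)
  have hF : ∀ᵐ U ∂(Measure.pi fun _ : Fin N => ν), ∀ n, U n ∈ D :=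
    ae_all_iff.2 fun n => (measurePreserving_eval (fun _ : Fin N => ν) n).quasiMeasurePreserving.ae
      (hν.ae_tsum_ne_top hαβ hl)
  -- Requiring all inputs to lie in the domain removes only a null set, so the probability bound is
  -- unchanged.
  refine ⟨E ∩ {U | ∀ n, U n ∈ D}, hE.inter ?_, hEp.trans (le_of_eq ?_), fun U hU => ?_⟩
  · have : {U : Fin N → H | ∀ n, U n ∈ D} = Set.univ.pi fun _ => D := by ext; simp
    rw [this]
    exact MeasurableSet.univ_pi fun _ => hDm
  · refine measureReal_congr ?_
    filter_upwards [hF] with U hU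
    exact propext ⟨fun h => ⟨h, hU⟩, fun h => h.1⟩
  · obtain ⟨hlow, hhigh⟩ := hEU U hU.1
    refine (expectedTestError_le φ hν' q hq hlq hμ_pos hη hη_indep U
      fun n => mem_domain_of_tsum_ne_top (hU.2 n)).trans
      (ENNReal.tsum_le_of_sum_range_le fun k => ?_)
    have hS : ∀ j, ∑ n, ⟪φ j, U n⟫ ^ 2
        = σ j * ∑ n, (⟪φ j, U n⟫ / Real.sqrt (σ j)) ^ 2 := fun j => by
      simp_rw [div_pow, Real.sq_sqrt (hσ0 j).le]
      rw [← Finset.sum_div, mul_div_cancel₀ _ (hσ0 j).ne']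
    rw [← ENNReal.ofReal_sum_of_nonneg fun j _ => mul_nonneg (hw0 j)
      (ridgeRisk_nonneg (Finset.sum_nonneg fun _ _ => sq_nonneg _))]
    refine ENNReal.ofReal_le_ofReal ?_
    simp_rw [hS]
    exact hrisk N hN _ (fun j => Finset.sum_nonneg fun _ _ => sq_nonneg _) hlow hhigh k
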